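/- Let $M$ be a compact smooth 4-manifold (without boundary) with an almost complex structure $J$, that is, a smooth endomorphism field of $TM$ with $J^2=-\mathrm{id}$. Call a symplectic form $\omega$ on $M$ compatible with $J$ if $\omega(JX,JY)=\omega(X,Y)$ for all tangent vectors $X,Y$ at a point and $\omega(X,JX)>0$ for $X\neq 0$. Let $\omega_1$ and $\omega_2$ be two smooth symplectic forms on $M$ that are compatible with $J$ and cohomologous, i.e. $\omega_2=\omega_1+db$ for some smooth 1-form $b$. If $\omega_1\wedge\omega_1=\omega_2\wedge\omega_2$ on $M$, then $\omega_1=\omega_2$. (In other words, solutions of the Calabi-Yau equation $\omega'^2=e^F\omega^2$ in $J$-compatible symplectic forms $\omega'$ are unique in their cohomology class.) -/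

import Mathlib

open scoped Manifold ContDiff Bundle

noncomputable section

namespace AlmostKahler

/-- A differential `k`-form (a priori without any regularity) on a manifold `M` of dimension `n`:
an alternating `k`-linear form on every tangent space. -/
abbrev DiffForm (n k : ℕ) (M : Type*) [TopologicalSpace M]
    [ChartedSpace (EuclideanSpace ℝ (Fin n)) M] : Type _ :=
  (x : M) → (TangentSpace (𝓡 n) x) [⋀^Fin k]→L[ℝ] ℝ

section Forms

variable {n k : ℕ} {M : Type*} [TopologicalSpace M] [ChartedSpace (EuclideanSpace ℝ (Fin n)) M]

/-- A form is smooth if it is a `C^∞` section of the bundle of alternating `k`-linear forms on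
the tangent bundle. -/
def IsSmoothForm [IsManifold (𝓡 n) ∞ M] (α : DiffForm n k M) : Prop :=
  ContMDiff (𝓡 n) ((𝓡 n).prod 𝓘(ℝ, EuclideanSpace ℝ (Fin n) [⋀^Fin k]→L[ℝ] ℝ)) ∞
    (fun x : M ↦
      (⟨x, α x⟩ : Bundle.TotalSpace (EuclideanSpace ℝ (Fin n) [⋀^Fin k]→L[ℝ] ℝ)
        (fun x : M ↦ (TangentSpace (𝓡 n) x) [⋀^Fin k]→L[ℝ] (Bundle.Trivial M ℝ x))))

/-- The form `α` read in the preferred chart around `x₀`, that is, its pullback under the inverse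
of this chart. It is meaningful on the target of the chart, which is open. -/
def formInChart (x₀ : M) (α : DiffForm n k M) (y : EuclideanSpace ℝ (Fin n)) :
    EuclideanSpace ℝ (Fin n) [⋀^Fin k]→L[ℝ] ℝ :=
  (α ((extChartAt (𝓡 n) x₀).symm y)).compContinuousLinearMap
    (mfderiv 𝓘(ℝ, EuclideanSpace ℝ (Fin n)) (𝓡 n) (extChartAt (𝓡 n) x₀).symm y)

/-- The exterior derivative of a form on `M`: read the form in the chart around `x`, take the
exterior derivative in Euclidean space, and pull the result back under the chart. -/
def extDerivForm (α : DiffForm n k M) : DiffForm n (k + 1) M := fun x ↦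
  (extDeriv (formInChart x α) (extChartAt (𝓡 n) x x)).compContinuousLinearMap
    (mfderiv (𝓡 n) 𝓘(ℝ, EuclideanSpace ℝ (Fin n)) (extChartAt (𝓡 n) x) x)

/-- The wedge product of real alternating forms on a vector space, normalized as the signed sum
over shuffles (so that `dx ∧ dy` takes the value `1` on the standard basis of the plane). -/
def wedge {V : Type*} [AddCommGroup V] [Module ℝ V] {k l : ℕ}
    (α : V [⋀^Fin k]→ₗ[ℝ] ℝ) (β : V [⋀^Fin l]→ₗ[ℝ] ℝ) : V [⋀^Fin (k + l)]→ₗ[ℝ] ℝ :=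
  ((LinearMap.mul' ℝ ℝ).compAlternatingMap (α.domCoprod β)).domDomCongr finSumFinEquiv

/-- The square `σ² = σ ∧ σ` of a 2-form at a point. -/
def sqForm (σ : DiffForm n 2 M) (x : M) : (TangentSpace (𝓡 n) x) [⋀^Fin 4]→ₗ[ℝ] ℝ :=
  wedge (σ x).toAlternatingMap (σ x).toAlternatingMap

/-- A symplectic form: a smooth, closed 2-form that is nondegenerate on every tangent space. -/
structure IsSymplecticForm [IsManifold (𝓡 n) ∞ M] (σ : DiffForm n 2 M) : Prop where
  smooth : IsSmoothForm σ
  closed : ∀ x, extDerivForm σ x = 0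
  nondegenerate : ∀ x, ∀ v : TangentSpace (𝓡 n) x, (∀ w, σ x ![v, w] = 0) → v = 0

/-- An almost complex structure: a smooth field of endomorphisms `J` of the tangent bundle
with `J² = -1`. -/
structure IsAlmostComplexStructure [IsManifold (𝓡 n) ∞ M]
    (J : (x : M) → TangentSpace (𝓡 n) x →L[ℝ] TangentSpace (𝓡 n) x) : Prop where
  smooth : ContMDiff (𝓡 n)
    ((𝓡 n).prod 𝓘(ℝ, EuclideanSpace ℝ (Fin n) →L[ℝ] EuclideanSpace ℝ (Fin n))) ∞
    (fun x : M ↦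
      (⟨x, J x⟩ : Bundle.TotalSpace (EuclideanSpace ℝ (Fin n) →L[ℝ] EuclideanSpace ℝ (Fin n))
        (fun x : M ↦ TangentSpace (𝓡 n) x →L[ℝ] TangentSpace (𝓡 n) x)))
  sq_eq : ∀ x, ∀ v : TangentSpace (𝓡 n) x, J x (J x v) = -v

/-- A 2-form `σ` is compatible with `J` if it is `J`-invariant and `σ(v, Jv) > 0` for `v ≠ 0`;
equivalently, `g = σ(·, J·)` is symmetric and positive definite. -/
structure IsCompatible (J : (x : M) → TangentSpace (𝓡 n) x →L[ℝ] TangentSpace (𝓡 n) x)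
    (σ : DiffForm n 2 M) : Prop where
  invariant : ∀ x, ∀ v w : TangentSpace (𝓡 n) x, σ x ![J x v, J x w] = σ x ![v, w]
  pos : ∀ x, ∀ v : TangentSpace (𝓡 n) x, v ≠ 0 → 0 < σ x ![v, J x v]

/-- Two forms of degree `k + 1` are cohomologous if they differ by the exterior derivative of a
smooth `k`-form. -/
def Cohomologous [IsManifold (𝓡 n) ∞ M] (α β : DiffForm n (k + 1) M) : Prop :=
  ∃ b : DiffForm n k M, IsSmoothForm b ∧ ∀ x, β x = α x + extDerivForm b x

end Forms

end AlmostKahler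

end

/-! Put `β = ω₂ - ω₁ = db` and `Ω = ω₁ + ω₂`. Since 2-forms commute, `β ∧ Ω = ω₂² - ω₁² = 0`, so `β`
is primitive for `Ω`. Moreover `Ω` is positive on `J`-complex lines and both forms are
`J`-invariant. In real dimension four a `J`-invariant primitive 2-form satisfies `β ∧ β ≤ 0`
relative to `Ω ∧ Ω`, with equality at a point only if `β` vanishes there
(`wedge_self_of_primitive`). But `β ∧ β = d(b ∧ db)` has integral zero on a closed manifold, so `β ∧
β = 0` everywhere and hence `β = 0`.

The integration avoids orientations: 4-forms are divided by `Ω ∧ Ω` (`topRatio`) and the resulting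
functions are integrated against the density `|Ω ∧ Ω|` in charts (`chartIntegral`), which is
independent of the chart (`chartIntegral_eq`). Stokes' theorem is proved for `ρ b ∧ db` with `ρ`
supported in one chart (`setIntegral_flux_add_eq_zero`), by reading it as the integral of a
divergence. For a partition of unity `ρᵢ`, the error terms `dρᵢ ∧ b ∧ db` cancel because `∑ dρᵢ =
0`, and the integrals of `ρᵢ db ∧ db` add up to zero (`topRatio_sqForm_extDerivForm_eq_zero`). -/

open scoped Manifold ContDiff Bundle

noncomputable section

namespace AlmostKahler

/-! ### Linear algebra of 2-forms in dimension four -/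

section PointwiseAlgebra

open Module Equiv

theorem sum_sign_mul_perm_fin_four (g : Fin 4 → Fin 4 → Fin 4 → Fin 4 → ℝ) :
    ∑ σ : Perm (Fin 4), ((Perm.sign σ : ℤ) : ℝ) * g (σ 0) (σ 1) (σ 2) (σ 3) =
      g 0 1 2 3 - g 0 1 3 2 - g 0 2 1 3 + g 0 2 3 1 + g 0 3 1 2 - g 0 3 2 1
      - g 1 0 2 3 + g 1 0 3 2 + g 1 2 0 3 - g 1 2 3 0 - g 1 3 0 2 + g 1 3 2 0
      + g 2 0 1 3 - g 2 0 3 1 - g 2 1 0 3 + g 2 1 3 0 + g 2 3 0 1 - g 2 3 1 0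
      - g 3 0 1 2 + g 3 0 2 1 + g 3 1 0 2 - g 3 1 2 0 - g 3 2 0 1 + g 3 2 1 0 := by
  -- Recording signs and values in a multiset removes `g`, so the enumeration of the 24 permutations
  -- becomes decidable.
  have h : (Finset.univ : Finset (Perm (Fin 4))).val.map
      (fun σ ↦ ((Perm.sign σ : ℤ), σ 0, σ 1, σ 2, σ 3)) =
      {(1, 0, 1, 2, 3), (-1, 0, 1, 3, 2), (-1, 0, 2, 1, 3), (1, 0, 2, 3, 1), (1, 0, 3, 1, 2),
       (-1, 0, 3, 2, 1), (-1, 1, 0, 2, 3), (1, 1, 0, 3, 2), (1, 1, 2, 0, 3), (-1, 1, 2, 3, 0),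
       (-1, 1, 3, 0, 2), (1, 1, 3, 2, 0), (1, 2, 0, 1, 3), (-1, 2, 0, 3, 1), (-1, 2, 1, 0, 3),
       (1, 2, 1, 3, 0), (1, 2, 3, 0, 1), (-1, 2, 3, 1, 0), (-1, 3, 0, 1, 2), (1, 3, 0, 2, 1),
       (1, 3, 1, 0, 2), (-1, 3, 1, 2, 0), (-1, 3, 2, 0, 1), (1, 3, 2, 1, 0)} := by
    decide +kernel
  have h2 := congrArg (fun s ↦ (s.map fun p : ℤ × Fin 4 × Fin 4 × Fin 4 × Fin 4 ↦
    (p.1 : ℝ) * g p.2.1 p.2.2.1 p.2.2.2.1 p.2.2.2.2).sum) h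
  simp only [Multiset.map_map, Function.comp_def] at h2
  refine h2.trans ?_
  simp
  ring

variable {V : Type*} [AddCommGroup V] [Module ℝ V]

/-- The factor is `2! * 2!`: summing over all permutations counts each shuffle that often. -/
theorem four_mul_wedge_apply_two_two (α β : V [⋀^Fin 2]→ₗ[ℝ] ℝ) (v : Fin 4 → V) :
    4 * wedge α β v = ∑ σ : Perm (Fin 4),
      ((Perm.sign σ : ℤ) : ℝ) * (α ![v (σ 0), v (σ 1)] * β ![v (σ 2), v (σ 3)]) := by
  have key := congrArg (fun f ↦ LinearMap.mul' ℝ ℝ (f (v ∘ finSumFinEquiv)))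
    (MultilinearMap.domCoprod_alternization_eq α β)
  have hw : wedge α β v = LinearMap.mul' ℝ ℝ (α.domCoprod β (v ∘ finSumFinEquiv)) := rfl
  simp only [MultilinearMap.alternatization_apply, AlternatingMap.smul_apply, map_sum,
    MultilinearMap.domDomCongr_apply, MultilinearMap.domCoprod_apply, map_nsmul,
    AlternatingMap.coe_multilinearMap] at key
  rw [← hw] at key
  have h4 : (4 : ℝ) * wedge α β v =
      ((Fintype.card (Fin 2)).factorial * (Fintype.card (Fin 2)).factorial) • wedge α β v := by
    norm_num [Nat.factorial]
  rw [h4, ← key, ← Equiv.sum_comp (finSumFinEquiv (m := 2) (n := 2)).permCongr]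
  refine Finset.sum_congr rfl fun σ _ ↦ ?_
  rw [Units.smul_def, map_zsmul]
  have e1 : ∀ x : Fin 2 → V, x = ![x 0, x 1] := fun x ↦ by ext i; fin_cases i <;> rfl
  rw [zsmul_eq_mul, LinearMap.mul'_apply]
  erw [Equiv.Perm.sign_permCongr]
  congr 2
  · congr 1
    rw [e1 (fun _ ↦ _)]
    rfl
  · congr 1
    rw [e1 (fun _ ↦ _)]
    rfl

theorem alternating_two_swap (α : V [⋀^Fin 2]→ₗ[ℝ] ℝ) (v w : V) : α ![w, v] = -α ![v, w] := by
  have h := α.map_swap ![v, w] (i := 0) (j := 1) (by decide)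
  rw [← h]
  congr 1
  ext i
  fin_cases i <;> simp

theorem alternating_two_self (α : V [⋀^Fin 2]→ₗ[ℝ] ℝ) (v : V) : α ![v, v] = 0 :=
  α.map_eq_zero_of_eq ![v, v] (i := 0) (j := 1) rfl (by decide)

theorem wedge_apply_two_two (α β : V [⋀^Fin 2]→ₗ[ℝ] ℝ) (v : Fin 4 → V) :
    wedge α β v = α ![v 0, v 1] * β ![v 2, v 3] - α ![v 0, v 2] * β ![v 1, v 3]
      + α ![v 0, v 3] * β ![v 1, v 2] + α ![v 1, v 2] * β ![v 0, v 3]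
      - α ![v 1, v 3] * β ![v 0, v 2] + α ![v 2, v 3] * β ![v 0, v 1] := by
  have h := four_mul_wedge_apply_two_two α β v
  rw [sum_sign_mul_perm_fin_four (fun i j k l ↦ α ![v i, v j] * β ![v k, v l])] at h
  simp only [alternating_two_swap α (v 0) (v 1), alternating_two_swap α (v 0) (v 2),
    alternating_two_swap α (v 0) (v 3), alternating_two_swap α (v 1) (v 2),
    alternating_two_swap α (v 1) (v 3), alternating_two_swap α (v 2) (v 3),
    alternating_two_swap β (v 0) (v 1), alternating_two_swap β (v 0) (v 2),
    alternating_two_swap β (v 0) (v 3), alternating_two_swap β (v 1) (v 2),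
    alternating_two_swap β (v 1) (v 3), alternating_two_swap β (v 2) (v 3)] at h
  linarith

/-- The 2-form `ℓ ∧ m` of two linear functionals. -/
def wedgeCovectors (ℓ m : V →ₗ[ℝ] ℝ) : V [⋀^Fin 2]→ₗ[ℝ] ℝ :=
  Matrix.detRowAlternating.compLinearMap (LinearMap.pi ![ℓ, m])

theorem wedgeCovectors_apply (ℓ m : V →ₗ[ℝ] ℝ) (v w : V) :
    wedgeCovectors ℓ m ![v, w] = ℓ v * m w - ℓ w * m v := by
  refine (Matrix.det_fin_two (Matrix.of fun i ↦ LinearMap.pi ![ℓ, m] (![v, w] i))).trans ?_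
  simp
  ring

/-- Top-degree forms are all multiples of one determinant, so the ratio of two of them does not
depend on the frame in which it is computed. -/
theorem alternating_mul_comm_of_basis {ι : Type*} [Fintype ι] [DecidableEq ι] (e : Basis ι ℝ V)
    (α β : V [⋀^ι]→ₗ[ℝ] ℝ) (v : ι → V) : α v * β e = α e * β v := by
  rw [α.eq_smul_basis_det e, β.eq_smul_basis_det e]
  simp [e.det_self]
  ring

/-- On a 4-dimensional space with complex structure `J`, a `J`-invariant 2-form which is primitive
for a compatible form `Ω` has `β ∧ β` nonpositive relative to `Ω ∧ Ω`, and vanishes if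
`β ∧ β = 0`. -/
theorem wedge_self_of_primitive (hV : finrank ℝ V = 4) (J : V →ₗ[ℝ] V)
    (hJ : ∀ v, J (J v) = -v) (Ω β : V [⋀^Fin 2]→ₗ[ℝ] ℝ)
    (hΩ : ∀ v w, Ω ![J v, J w] = Ω ![v, w]) (hpos : ∀ v, v ≠ 0 → 0 < Ω ![v, J v])
    (hβ : ∀ v w, β ![J v, J w] = β ![v, w]) (hprim : wedge β Ω = 0) (e : Basis (Fin 4) ℝ V) :
    wedge Ω Ω e ≠ 0 ∧ wedge β β e / wedge Ω Ω e ≤ 0 ∧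
      (wedge β β e / wedge Ω Ω e = 0 → β = 0) := by
  have : FiniteDimensional ℝ V := .of_finrank_pos (by omega)
  obtain ⟨u, hu⟩ : ∃ u : V, u ≠ 0 := by
    have : Nontrivial V := Module.nontrivial_of_finrank_pos (R := ℝ) (by omega)
    exact exists_ne 0
  let Ωl : V → V →ₗ[ℝ] ℝ := fun a ↦ Ω.toMultilinearMap.toLinearMap ![a, 0] 1
  have hΩl : ∀ a v, Ωl a v = Ω ![a, v] := fun a v ↦ by
    change Ω (Function.update ![a, 0] 1 v) = _
    congr 1
    ext i
    fin_cases i <;> simp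
  -- Two linear conditions on a 4-dimensional space leave a nonzero `v` that is `Ω`-orthogonal to
  -- `u` and `J u`. By invariance `J v` is orthogonal to them too, so `Ω` is block diagonal in the
  -- frame `u, J u, v, J v`.
  obtain ⟨v, hvker, hv⟩ : ∃ v ∈ LinearMap.ker ((Ωl u).prod (Ωl (J u))), v ≠ 0 := by
    refine (Submodule.ne_bot_iff _).1 (LinearMap.ker_ne_bot_of_finrank_lt ?_)
    rw [hV]
    simp
  have hk : Ω ![u, v] = 0 ∧ Ω ![J u, v] = 0 := by
    simpa [hΩl] using hvker
  have hp := hpos u hu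
  have hq := hpos v hv
  have h1 : Ω ![J u, J v] = 0 := by rw [hΩ]; exact hk.1
  have h2 : Ω ![u, J v] = 0 := by
    have hneg : Ω ![J u, -v] = -Ω ![J u, v] := by simpa [hΩl] using (Ωl (J u)).map_neg v
    rw [← hΩ, hJ, hneg, hk.2, neg_zero]
  let βl : V → V →ₗ[ℝ] ℝ := fun a ↦ β.toMultilinearMap.toLinearMap ![a, 0] 1
  have hβl : ∀ a v, βl a v = β ![a, v] := fun a v ↦ by
    change β (Function.update ![a, 0] 1 v) = _
    congr 1
    ext i
    fin_cases i <;> simp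
  have h3 : β ![J u, J v] = β ![u, v] := hβ u v
  have h4 : β ![J u, v] = -β ![u, J v] := by
    have hneg : β ![J u, -v] = -β ![J u, v] := by simpa [hβl] using (βl (J u)).map_neg v
    have := hβ u (J v)
    rw [hJ, hneg] at this
    linarith
  let f : Fin 4 → V := ![u, J u, v, J v]
  have eΩ : wedge Ω Ω f = 2 * (Ω ![u, J u] * Ω ![v, J v]) := by
    rw [wedge_apply_two_two]
    simp only [f, Matrix.cons_val, hk.1, hk.2, h1, h2]
    ring
  -- A dependent family would annihilate `Ω ∧ Ω`, whose value here is positive.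
  have hli : LinearIndependent ℝ f := by
    by_contra hcon
    have := (wedge Ω Ω).map_linearDependent f hcon
    rw [eΩ] at this
    exact absurd this (by positivity)
  let F : Basis (Fin 4) ℝ V := basisOfLinearIndependentOfCardEqFinrank hli (by simp [hV])
  have hF : (F : Fin 4 → V) = f := coe_basisOfLinearIndependentOfCardEqFinrank hli _
  have hΩe : wedge Ω Ω e ≠ 0 := by
    rw [AlternatingMap.map_basis_ne_zero_iff, ← AlternatingMap.map_basis_ne_zero_iff F, hF, eΩ]
    positivity
  have eβ : wedge β β f = 2 * (β ![u, J u] * β ![v, J v] - β ![u, v] ^ 2 - β ![u, J v] ^ 2) := by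
    rw [wedge_apply_two_two]
    simp only [f, Matrix.cons_val, h3, h4]
    ring
  have eprim : β ![u, J u] * Ω ![v, J v] + β ![v, J v] * Ω ![u, J u] = 0 := by
    have := congrArg (fun μ ↦ μ f) hprim
    simp only [wedge_apply_two_two, f, Matrix.cons_val, hk.1, hk.2, h1, h2, h3, h4,
      AlternatingMap.zero_apply] at this
    linarith
  have hratio : wedge β β e / wedge Ω Ω e = wedge β β f / wedge Ω Ω f := by
    rw [div_eq_div_iff hΩe (by rw [eΩ]; positivity), ← hF]
    exact alternating_mul_comm_of_basis F _ _ _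
  rw [hratio, eΩ, eβ, mul_div_mul_left _ _ two_ne_zero]
  -- Primitivity forces the two diagonal entries of `β` to have opposite signs. Eliminating one of
  -- them turns the whole expression into minus a sum of squares with positive weights.
  have hpW : Ω ![u, J u] * (β ![u, J u] * β ![v, J v] - β ![u, v] ^ 2 - β ![u, J v] ^ 2) =
      -(β ![u, J u] ^ 2 * Ω ![v, J v] + β ![u, v] ^ 2 * Ω ![u, J u]
        + β ![u, J v] ^ 2 * Ω ![u, J u]) := by
    linear_combination β ![u, J u] * eprim
  have hn1 : 0 ≤ β ![u, J u] ^ 2 * Ω ![v, J v] := by positivity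
  have hn2 : 0 ≤ β ![u, v] ^ 2 * Ω ![u, J u] := by positivity
  have hn3 : 0 ≤ β ![u, J v] ^ 2 * Ω ![u, J u] := by positivity
  refine ⟨hΩe, ?_, fun h ↦ ?_⟩
  · refine div_nonpos_of_nonpos_of_nonneg ?_ (by positivity)
    exact nonpos_of_mul_nonpos_right (by rw [hpW]; linarith) hp
  · have hW := (div_eq_zero_iff.1 h).resolve_right (by positivity)
    rw [hW, mul_zero] at hpW
    have ha : β ![u, J u] = 0 := by
      have h0 : β ![u, J u] ^ 2 * Ω ![v, J v] = 0 := by linarith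
      simpa [hq.ne'] using h0
    have hr : β ![u, v] = 0 := by
      have h0 : β ![u, v] ^ 2 * Ω ![u, J u] = 0 := by linarith
      simpa [hp.ne'] using h0
    have hs : β ![u, J v] = 0 := by
      have h0 : β ![u, J v] ^ 2 * Ω ![u, J u] = 0 := by linarith
      simpa [hp.ne'] using h0
    have hc : β ![v, J v] = 0 := by
      rw [ha, zero_mul, zero_add] at eprim
      exact (mul_eq_zero.1 eprim).resolve_right hp.ne'
    rw [hr] at h3
    rw [hs, neg_zero] at h4
    have hsw : ∀ a b, β ![a, b] = 0 → β ![b, a] = 0 := fun a b hab ↦ by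
      rw [alternating_two_swap, hab, neg_zero]
    refine Basis.ext_alternating F fun k _ ↦ ?_
    have hk2 : (fun i ↦ F (k i)) = ![f (k 0), f (k 1)] := by
      rw [hF]
      ext i
      fin_cases i <;> rfl
    rw [hk2, AlternatingMap.zero_apply]
    generalize k 0 = i
    generalize k 1 = j
    fin_cases i <;> fin_cases j <;>
      simp [f, ha, hr, hs, hc, h3, h4, hsw _ _ ha, hsw _ _ hr, hsw _ _ hs, hsw _ _ hc, hsw _ _ h3,
        hsw _ _ h4, alternating_two_self]

end PointwiseAlgebra

/-! ### Forms read in charts, and change of chart -/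

section Charts

open Topology Set

variable {n k : ℕ} {M : Type*} [TopologicalSpace M] [ChartedSpace (EuclideanSpace ℝ (Fin n)) M]

theorem minSmoothness_two_le_infty : minSmoothness ℝ 2 ≤ ∞ := by
  rw [minSmoothness_of_isRCLikeNormedField]
  exact WithTop.coe_le_coe.2 (le_top (a := (2 : ℕ∞)))

theorem formInChart_apply (j : M) (α : DiffForm n k M) (y : EuclideanSpace ℝ (Fin n))
    (v : Fin k → EuclideanSpace ℝ (Fin n)) :
    formInChart j α y v = α ((extChartAt (𝓡 n) j).symm y) (fun i ↦
      mfderiv 𝓘(ℝ, EuclideanSpace ℝ (Fin n)) (𝓡 n) (extChartAt (𝓡 n) j).symm y (v i)) :=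
  rfl

/-- Every tangent space is by definition the model space, so one tuple of vectors can be used at two
points that are only propositionally equal. -/
theorem diffForm_apply_congr (α : DiffForm n k M) {p q : M} (h : p = q)
    (v : Fin k → EuclideanSpace ℝ (Fin n)) :
    α p (fun i ↦ (v i : TangentSpace (𝓡 n) p)) = α q (fun i ↦ (v i : TangentSpace (𝓡 n) q)) := by
  subst h
  rfl

variable [IsManifold (𝓡 n) ∞ M]

theorem contMDiffAt_extChartAt_symm_of_mem (j : M) {y : EuclideanSpace ℝ (Fin n)}
    (hy : y ∈ (extChartAt (𝓡 n) j).target) :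
    ContMDiffAt 𝓘(ℝ, EuclideanSpace ℝ (Fin n)) (𝓡 n) ∞ (extChartAt (𝓡 n) j).symm y :=
  (contMDiffOn_extChartAt_symm j).contMDiffAt ((isOpen_extChartAt_target j).mem_nhds hy)

theorem contDiffAt_chart_transition (j x : M) {y : EuclideanSpace ℝ (Fin n)}
    (hy : y ∈ (extChartAt (𝓡 n) j).target)
    (hx : (extChartAt (𝓡 n) j).symm y ∈ (extChartAt (𝓡 n) x).source) :
    ContDiffAt ℝ ∞ (extChartAt (𝓡 n) x ∘ (extChartAt (𝓡 n) j).symm) y := by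
  rw [← contMDiffAt_iff_contDiffAt]
  refine (contMDiffAt_extChartAt' ?_).comp y (contMDiffAt_extChartAt_symm_of_mem j hy)
  rwa [extChartAt_source] at hx

theorem eventually_mem_chart_overlap (j x : M) {y : EuclideanSpace ℝ (Fin n)}
    (hy : y ∈ (extChartAt (𝓡 n) j).target)
    (hx : (extChartAt (𝓡 n) j).symm y ∈ (extChartAt (𝓡 n) x).source) :
    ∀ᶠ z in 𝓝 y, z ∈ (extChartAt (𝓡 n) j).target ∧
      (extChartAt (𝓡 n) j).symm z ∈ (extChartAt (𝓡 n) x).source :=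
  ((isOpen_extChartAt_target j).mem_nhds hy |> Filter.Eventually.and <|
    (contMDiffAt_extChartAt_symm_of_mem j hy).continuousAt.eventually
      ((isOpen_extChartAt_source x).mem_nhds hx))

theorem mfderiv_extChartAt_symm_transition (j x : M) {y : EuclideanSpace ℝ (Fin n)}
    (hy : y ∈ (extChartAt (𝓡 n) j).target)
    (hx : (extChartAt (𝓡 n) j).symm y ∈ (extChartAt (𝓡 n) x).source)
    (v : EuclideanSpace ℝ (Fin n)) :
    (mfderiv 𝓘(ℝ, EuclideanSpace ℝ (Fin n)) (𝓡 n) (extChartAt (𝓡 n) j).symm y v :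
        EuclideanSpace ℝ (Fin n)) =
      mfderiv 𝓘(ℝ, EuclideanSpace ℝ (Fin n)) (𝓡 n) (extChartAt (𝓡 n) x).symm
        ((extChartAt (𝓡 n) x ∘ (extChartAt (𝓡 n) j).symm) y)
        (fderiv ℝ (extChartAt (𝓡 n) x ∘ (extChartAt (𝓡 n) j).symm) y v) := by
  have h1 : (extChartAt (𝓡 n) j).symm =ᶠ[𝓝 y]
      (extChartAt (𝓡 n) x).symm ∘ (extChartAt (𝓡 n) x ∘ (extChartAt (𝓡 n) j).symm) := by
    filter_upwards [eventually_mem_chart_overlap j x hy hx] with z hz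
    exact ((extChartAt (𝓡 n) x).left_inv hz.2).symm
  have h2 := h1.mfderiv_eq (I := 𝓘(ℝ, EuclideanSpace ℝ (Fin n))) (I' := 𝓡 n)
  have h3 := mfderiv_comp (I := 𝓘(ℝ, EuclideanSpace ℝ (Fin n)))
    (I' := 𝓘(ℝ, EuclideanSpace ℝ (Fin n))) (I'' := 𝓡 n) y
    ((contMDiffAt_extChartAt_symm_of_mem x ((extChartAt (𝓡 n) x).map_source hx)).mdifferentiableAt
      (by simp) : MDifferentiableAt _ _ _
        ((extChartAt (𝓡 n) x ∘ (extChartAt (𝓡 n) j).symm) y))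
    ((contDiffAt_chart_transition j x hy hx).contMDiffAt.mdifferentiableAt (by simp))
  have h4 := congrArg (fun L : EuclideanSpace ℝ (Fin n) →L[ℝ] EuclideanSpace ℝ (Fin n) ↦ L v)
    (h2.trans h3)
  rw [mfderiv_eq_fderiv] at h4
  exact h4

theorem formInChart_transition (j x : M) (α : DiffForm n k M) {y : EuclideanSpace ℝ (Fin n)}
    (hy : y ∈ (extChartAt (𝓡 n) j).target)
    (hx : (extChartAt (𝓡 n) j).symm y ∈ (extChartAt (𝓡 n) x).source) :
    formInChart j α y =
      (formInChart x α ((extChartAt (𝓡 n) x ∘ (extChartAt (𝓡 n) j).symm) y)).compContinuousLinearMap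
        (fderiv ℝ (extChartAt (𝓡 n) x ∘ (extChartAt (𝓡 n) j).symm) y) := by
  ext v
  have h := diffForm_apply_congr α ((extChartAt (𝓡 n) x).left_inv hx).symm (fun i ↦
    mfderiv 𝓘(ℝ, EuclideanSpace ℝ (Fin n)) (𝓡 n) (extChartAt (𝓡 n) j).symm y (v i))
  refine h.trans ?_
  simp only [mfderiv_extChartAt_symm_transition j x hy hx]
  rfl

theorem formInChart_transition_eventuallyEq (j x : M) (α : DiffForm n k M)
    {y : EuclideanSpace ℝ (Fin n)} (hy : y ∈ (extChartAt (𝓡 n) j).target)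
    (hx : (extChartAt (𝓡 n) j).symm y ∈ (extChartAt (𝓡 n) x).source) :
    formInChart j α =ᶠ[𝓝 y] fun z ↦
      (formInChart x α ((extChartAt (𝓡 n) x ∘ (extChartAt (𝓡 n) j).symm) z)).compContinuousLinearMap
        (fderiv ℝ (extChartAt (𝓡 n) x ∘ (extChartAt (𝓡 n) j).symm) z) := by
  filter_upwards [eventually_mem_chart_overlap j x hy hx] with z hz
  exact formInChart_transition j x α hz.1 hz.2

theorem mfderiv_extChartAt_symm_self (x : M) (v : EuclideanSpace ℝ (Fin n)) :
    (mfderiv 𝓘(ℝ, EuclideanSpace ℝ (Fin n)) (𝓡 n) (extChartAt (𝓡 n) x).symm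
      (extChartAt (𝓡 n) x x) v : EuclideanSpace ℝ (Fin n)) = v := by
  have : IsManifold (𝓡 n) 1 M := IsManifold.of_le (n := ∞) (by simp)
  have h := mfderivWithin_range_extChartAt_symm (I := 𝓡 n) (x := x)
  rw [ModelWithCorners.range_eq_univ, mfderivWithin_univ] at h
  exact congrArg (fun L : EuclideanSpace ℝ (Fin n) →L[ℝ] EuclideanSpace ℝ (Fin n) ↦ L v) h

theorem formInChart_self (x : M) (α : DiffForm n k M) :
    formInChart x α (extChartAt (𝓡 n) x x) = α x := by
  ext v
  have h := diffForm_apply_congr α (extChartAt_to_inv (I := 𝓡 n) x) (fun i ↦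
    mfderiv 𝓘(ℝ, EuclideanSpace ℝ (Fin n)) (𝓡 n) (extChartAt (𝓡 n) x).symm
      (extChartAt (𝓡 n) x x) (v i))
  refine h.trans ?_
  simp only [mfderiv_extChartAt_symm_self]
  rfl

theorem extDerivForm_eq (x : M) (α : DiffForm n k M) :
    extDerivForm α x = extDeriv (formInChart x α) (extChartAt (𝓡 n) x x) := by
  have : IsManifold (𝓡 n) 1 M := IsManifold.of_le (n := ∞) (by simp)
  ext v
  simp only [extDerivForm, mfderiv_extChartAt_self]
  rfl

/-- A smooth form, read in the chart around `x`, is smooth at the image of `x`. -/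
theorem IsSmoothForm.contDiffAt_formInChart_self {α : DiffForm n k M} (hα : IsSmoothForm α)
    (x : M) : ContDiffAt ℝ ∞ (formInChart x α) (extChartAt (𝓡 n) x x) := by
  have : IsManifold (𝓡 n) 1 M := IsManifold.of_le (n := ∞) (by simp)
  have h := (Bundle.contMDiffAt_totalSpace.1 (hα x)).2
  have h2 := h.comp_of_eq (contMDiffAt_extChartAt_symm_of_mem x (mem_extChartAt_target x))
    (by simp)
  rw [contMDiffAt_iff_contDiffAt] at h2
  refine h2.congr_of_eventuallyEq ?_
  filter_upwards [(isOpen_extChartAt_target x).mem_nhds (mem_extChartAt_target x)] with y hy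
  have hys : (extChartAt (𝓡 n) x).symm y ∈ (chartAt (EuclideanSpace ℝ (Fin n)) x).source := by
    rw [← extChartAt_source (𝓡 n)]
    exact (extChartAt (𝓡 n) x).map_target hy
  ext v
  rw [formInChart_apply, Function.comp_apply,
    FiberBundle.trivializationAt_continuousAlternatingMap_apply]
  simp only [ContinuousAlternatingMap.inCoordinates]
  rw [TangentBundle.symmL_trivializationAt hys, (extChartAt (𝓡 n) x).right_inv hy,
    ModelWithCorners.range_eq_univ, mfderivWithin_univ]
  simp
  rfl

/-- `extDerivForm` uses a different chart at each point. A single chart `j` serves throughout its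
target, because the exterior derivative commutes with pullback along transition maps. -/
theorem extDeriv_formInChart (j : M) {b : DiffForm n k M} (hb : IsSmoothForm b)
    {y : EuclideanSpace ℝ (Fin n)} (hy : y ∈ (extChartAt (𝓡 n) j).target) :
    formInChart j (extDerivForm b) y = extDeriv (formInChart j b) y := by
  have hx := mem_extChartAt_source (I := 𝓡 n) ((extChartAt (𝓡 n) j).symm y)
  rw [formInChart_transition j ((extChartAt (𝓡 n) j).symm y) _ hy hx]
  have hev := formInChart_transition_eventuallyEq j _ b hy hx
  have hd : DifferentiableAt ℝ (formInChart ((extChartAt (𝓡 n) j).symm y) b)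
      ((extChartAt (𝓡 n) ((extChartAt (𝓡 n) j).symm y) ∘ (extChartAt (𝓡 n) j).symm) y) :=
    (hb.contDiffAt_formInChart_self _).differentiableAt (by simp)
  rw [hev.extDeriv_eq, extDeriv_pullback (r := ∞) hd (contDiffAt_chart_transition j _ hy hx)
    minSmoothness_two_le_infty, Function.comp_apply,
    formInChart_self, extDerivForm_eq]

theorem IsSmoothForm.differentiableAt_formInChart {α : DiffForm n k M} (hα : IsSmoothForm α)
    (j : M) {y : EuclideanSpace ℝ (Fin n)} (hy : y ∈ (extChartAt (𝓡 n) j).target) :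
    DifferentiableAt ℝ (formInChart j α) y := by
  have hx := mem_extChartAt_source (I := 𝓡 n) ((extChartAt (𝓡 n) j).symm y)
  have hτ := contDiffAt_chart_transition j _ hy hx
  have hev := formInChart_transition_eventuallyEq j _ α hy hx
  have hd : DifferentiableAt ℝ (formInChart ((extChartAt (𝓡 n) j).symm y) α)
      ((extChartAt (𝓡 n) ((extChartAt (𝓡 n) j).symm y) ∘ (extChartAt (𝓡 n) j).symm) y) :=
    (hα.contDiffAt_formInChart_self _).differentiableAt (by simp)
  refine DifferentiableAt.congr_of_eventuallyEq ?_ hev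
  exact DifferentiableAt.continuousAlternatingMapCompContinuousLinearMap
    (hd.comp y (hτ.differentiableAt (by simp)))
    ((hτ.fderiv_right (m := ∞) (by simp)).differentiableAt (by simp))

/-- Smoothness is available at the centre of each preferred chart; the transition map from `j` to
the chart centred at the given point carries it over. -/
theorem IsSmoothForm.contDiffOn_formInChart_apply {α : DiffForm n k M} (hα : IsSmoothForm α)
    (j : M) (v : Fin k → EuclideanSpace ℝ (Fin n)) :
    ContDiffOn ℝ ∞ (fun y ↦ formInChart j α y v) (extChartAt (𝓡 n) j).target := by
  intro y hy
  refine ContDiffAt.contDiffWithinAt ?_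
  have hx := mem_extChartAt_source (I := 𝓡 n) ((extChartAt (𝓡 n) j).symm y)
  have hτ := contDiffAt_chart_transition j _ hy hx
  set τ := extChartAt (𝓡 n) ((extChartAt (𝓡 n) j).symm y) ∘ (extChartAt (𝓡 n) j).symm with hτdef
  set g := formInChart ((extChartAt (𝓡 n) j).symm y) α with hg
  have hev : (fun z ↦ formInChart j α z v) =ᶠ[𝓝 y] fun z ↦
      ContinuousMultilinearMap.apply ℝ _ ℝ v
      ((g (τ z)).toContinuousMultilinearMap.compContinuousLinearMap fun _ ↦ fderiv ℝ τ z) := by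
    filter_upwards [eventually_mem_chart_overlap j _ hy hx] with z hz
    rw [formInChart_transition j _ α hz.1 hz.2]
    rfl
  refine ContDiffAt.congr_of_eventuallyEq ?_ hev
  refine (ContinuousLinearMap.contDiff _).contDiffAt.comp y ?_
  have hp : ContDiffAt ℝ ∞ (fun z ↦ ((fun _ : Fin k ↦ fderiv ℝ τ z),
      (g (τ z)).toContinuousMultilinearMap)) y := by
    refine ContDiffAt.prodMk (contDiffAt_pi.2 fun _ ↦ hτ.fderiv_right (by simp)) ?_
    have hL := (ContinuousAlternatingMap.toContinuousMultilinearMapLI (𝕜 := ℝ)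
      (E := EuclideanSpace ℝ (Fin n)) (ι := Fin k) (F := ℝ)).toContinuousLinearMap.contDiff
      (n := ∞)
    exact hL.contDiffAt.comp y (ContDiffAt.comp y (hα.contDiffAt_formInChart_self _) hτ)
  exact (ContinuousMultilinearMap.cpolynomialAt_uncurry_compContinuousLinearMap.contDiffAt).comp y
    hp

end Charts

/-! ### Divergence identities and integrals in Euclidean space -/

section Euclidean

open Topology Set MeasureTheory

variable {E : Type*} [NormedAddCommGroup E] [NormedSpace ℝ E]

theorem contDiff_indicator_of_eq_zero_off {U K : Set E} (hU : IsOpen U) (hK : IsClosed K)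
    (hKU : K ⊆ U) {m : ℕ∞ω} {f : E → ℝ} (hf : ContDiffOn ℝ m f U)
    (h0 : ∀ y ∈ U, y ∉ K → f y = 0) : ContDiff ℝ m (U.indicator f) := by
  rw [contDiff_iff_contDiffAt]
  intro y
  by_cases hy : y ∈ U
  · refine (hf.contDiffAt (hU.mem_nhds hy)).congr_of_eventuallyEq ?_
    filter_upwards [hU.mem_nhds hy] with z hz using indicator_of_mem hz f
  · have hyK : y ∉ K := fun h ↦ hy (hKU h)
    refine (contDiffAt_const (c := (0 : ℝ))).congr_of_eventuallyEq ?_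
    filter_upwards [hK.isOpen_compl.mem_nhds hyK] with z hz
    exact indicator_apply_eq_zero.2 fun hzU ↦ h0 z hzU hz

theorem hasCompactSupport_indicator_of_eq_zero_off {E : Type*} [NormedAddCommGroup E]
    {U K : Set E} (hK : IsCompact K) {f : E → ℝ}
    (h0 : ∀ y ∈ U, y ∉ K → f y = 0) : HasCompactSupport (U.indicator f) :=
  .intro hK fun y hy ↦ indicator_apply_eq_zero.2 fun hyU ↦ h0 y hyU hy

/-- The vector field dual to the 3-form `b ∧ β` in dimension four. -/
def dualField (b : Fin 4 → E → ℝ) (β : Fin 4 → Fin 4 → E → ℝ) : Fin 4 → E → ℝ :=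
  ![fun y ↦ b 1 y * β 2 3 y - b 2 y * β 1 3 y + b 3 y * β 1 2 y,
    fun y ↦ -(b 0 y * β 2 3 y - b 2 y * β 0 3 y + b 3 y * β 0 2 y),
    fun y ↦ b 0 y * β 1 3 y - b 1 y * β 0 3 y + b 3 y * β 0 1 y,
    fun y ↦ -(b 0 y * β 1 2 y - b 1 y * β 0 2 y + b 2 y * β 0 1 y)]

theorem contDiffOn_dualField {b : Fin 4 → E → ℝ} {β : Fin 4 → Fin 4 → E → ℝ} {U : Set E}
    {m : ℕ∞ω} (hb : ∀ i, ContDiffOn ℝ m (b i) U) (hβ : ∀ i j, ContDiffOn ℝ m (β i j) U)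
    (i : Fin 4) : ContDiffOn ℝ m (dualField b β i) U := by
  have h : ∀ i j k, ContDiffOn ℝ m (fun y ↦ b i y * β j k y) U := fun i j k ↦ (hb i).mul (hβ j k)
  fin_cases i
  · exact ((h 1 2 3).sub (h 2 1 3)).add (h 3 1 2)
  · exact (((h 0 2 3).sub (h 2 0 3)).add (h 3 0 2)).neg
  · exact ((h 0 1 3).sub (h 1 0 3)).add (h 3 0 1)
  · exact (((h 0 1 2).sub (h 1 0 2)).add (h 2 0 1)).neg

/-- This is `d(u b ∧ β) = du ∧ b ∧ β + u β ∧ β` in coordinates, given `β = db` and `dβ = 0`. -/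
theorem sum_fderiv_mul_dualField {u : E → ℝ} {b : Fin 4 → E → ℝ} {β : Fin 4 → Fin 4 → E → ℝ}
    {y : E} (e : Fin 4 → E) (hu : DifferentiableAt ℝ u y) (hb : ∀ i, DifferentiableAt ℝ (b i) y)
    (hβ : ∀ i j, DifferentiableAt ℝ (β i j) y)
    (hdb : ∀ i j, β i j y = fderiv ℝ (b j) y (e i) - fderiv ℝ (b i) y (e j))
    (hdβ : ∀ i j k, fderiv ℝ (β j k) y (e i) - fderiv ℝ (β i k) y (e j)
      + fderiv ℝ (β i j) y (e k) = 0) :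
    ∑ k, fderiv ℝ (fun z ↦ u z * dualField b β k z) y (e k) =
      (∑ k, fderiv ℝ u y (e k) * dualField b β k y) +
        u y * (2 * (β 0 1 y * β 2 3 y - β 0 2 y * β 1 3 y + β 0 3 y * β 1 2 y)) := by
  have hm : ∀ i j k, HasFDerivAt (fun z ↦ b i z * β j k z)
      (b i y • fderiv ℝ (β j k) y + β j k y • fderiv ℝ (b i) y) y := fun i j k ↦
    (hb i).hasFDerivAt.mul (hβ j k).hasFDerivAt
  have h0 := hu.hasFDerivAt.mul (((hm 1 2 3).sub (hm 2 1 3)).add (hm 3 1 2))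
  have h1 := hu.hasFDerivAt.mul (((hm 0 2 3).sub (hm 2 0 3)).add (hm 3 0 2)).neg
  have h2 := hu.hasFDerivAt.mul (((hm 0 1 3).sub (hm 1 0 3)).add (hm 3 0 1))
  have h3 := hu.hasFDerivAt.mul (((hm 0 1 2).sub (hm 1 0 2)).add (hm 2 0 1)).neg
  have e0 : fderiv ℝ (fun z ↦ u z * dualField b β 0 z) y = _ := h0.fderiv
  have e1 : fderiv ℝ (fun z ↦ u z * dualField b β 1 z) y = _ := h1.fderiv
  have e2 : fderiv ℝ (fun z ↦ u z * dualField b β 2 z) y = _ := h2.fderiv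
  have e3 : fderiv ℝ (fun z ↦ u z * dualField b β 3 z) y = _ := h3.fderiv
  rw [Fin.sum_univ_four, Fin.sum_univ_four, e0, e1, e2, e3]
  simp only [dualField, Matrix.cons_val, _root_.add_apply, _root_.smul_apply, _root_.sub_apply,
    _root_.neg_apply,
    smul_eq_mul, Pi.add_apply, Pi.sub_apply, Pi.neg_apply]
  have c012 := hdβ 0 1 2
  have c013 := hdβ 0 1 3
  have c023 := hdβ 0 2 3
  have c123 := hdβ 1 2 3
  linear_combination (u y * b 0 y) * (-c123) + (u y * b 1 y) * c023 - (u y * b 2 y) * c013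
    + (u y * b 3 y) * c012 - u y * (β 2 3 y * hdb 0 1 - β 1 3 y * hdb 0 2 + β 1 2 y * hdb 0 3
      + β 0 3 y * hdb 1 2 - β 0 2 y * hdb 1 3 + β 0 1 y * hdb 2 3)

variable [MeasurableSpace E] [BorelSpace E] {μ : Measure E}

theorem integrableOn_of_continuousOn_of_eq_zero_off [IsFiniteMeasureOnCompacts μ] {U K : Set E}
    (hU : IsOpen U) (hK : IsCompact K) (hKU : K ⊆ U) {f : E → ℝ} (hf : ContinuousOn f U)
    (h0 : ∀ y ∈ U, y ∉ K → f y = 0) : IntegrableOn f U μ := by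
  rw [← integrable_indicator_iff hU.measurableSet]
  exact (contDiff_indicator_of_eq_zero_off hU hK.isClosed hKU (contDiffOn_zero.2 hf)
    h0).continuous.integrable_of_hasCompactSupport (hasCompactSupport_indicator_of_eq_zero_off hK h0)

theorem integral_fderiv_apply_eq_zero_of_hasCompactSupport [FiniteDimensional ℝ E]
    [μ.IsAddHaarMeasure] {f : E → ℝ} (hf : ContDiff ℝ 1 f) (hs : HasCompactSupport f) (v : E) :
    ∫ y, fderiv ℝ f y v ∂μ = 0 := by
  have hi : Integrable (fun y ↦ fderiv ℝ f y v) μ :=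
    ((hf.continuous_fderiv one_ne_zero).clm_apply continuous_const).integrable_of_hasCompactSupport
      (hs.fderiv_apply ℝ v)
  have h := integral_mul_fderiv_eq_neg_fderiv_mul_of_integrable (μ := μ) (𝕜 := ℝ)
    (f := fun _ ↦ (1 : ℝ)) (g := f) (v := v) (by simp) (by simpa using hi)
    (by simpa using hf.continuous.integrable_of_hasCompactSupport hs) (by simp)
    (fun x _ ↦ hf.differentiable one_ne_zero x)
  simpa using h

/-- The integral over `U` of a derivative of a function supported in a compact subset of `U`,
weighted by a locally constant function, vanishes. -/
theorem setIntegral_locallyConstant_mul_fderiv_eq_zero [FiniteDimensional ℝ E]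
    [μ.IsAddHaarMeasure] {U K : Set E} (hU : IsOpen U) (hK : IsCompact K) (hKU : K ⊆ U)
    {s f : E → ℝ} (hs : ∀ y ∈ U, ∀ᶠ z in 𝓝 y, s z = s y) (hf : ContDiffOn ℝ 1 f U)
    (h0 : ∀ y ∈ U, y ∉ K → f y = 0) (v : E) :
    IntegrableOn (fun y ↦ s y * fderiv ℝ f y v) U μ ∧ ∫ y in U, s y * fderiv ℝ f y v ∂μ = 0 := by
  -- Near each point the weight is a constant, so it moves inside the derivative, and `s * f`
  -- extends by zero to a compactly supported `C¹` function.
  have hev : ∀ y ∈ U, (fun z ↦ s z * f z) =ᶠ[𝓝 y] fun z ↦ s y * f z := fun y hy ↦ by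
    filter_upwards [hs y hy] with z hz
    rw [hz]
  have hsf : ContDiffOn ℝ 1 (fun z ↦ s z * f z) U := fun y hy ↦
    ((contDiffAt_const.mul (hf.contDiffAt (hU.mem_nhds hy))).congr_of_eventuallyEq
      (hev y hy)).contDiffWithinAt
  have hsf0 : ∀ y ∈ U, y ∉ K → s y * f y = 0 := fun y hy hyK ↦ by rw [h0 y hy hyK, mul_zero]
  have hc := contDiff_indicator_of_eq_zero_off hU hK.isClosed hKU hsf hsf0
  have hcs := hasCompactSupport_indicator_of_eq_zero_off hK hsf0
  have hfd : (fun y ↦ fderiv ℝ (U.indicator fun z ↦ s z * f z) y v) =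
      U.indicator fun y ↦ s y * fderiv ℝ f y v := by
    ext y
    by_cases hy : y ∈ U
    · rw [indicator_of_mem hy]
      have h1 : U.indicator (fun z ↦ s z * f z) =ᶠ[𝓝 y] fun z ↦ s y * f z := by
        filter_upwards [hU.mem_nhds hy, hev y hy] with z hz hz'
        rw [indicator_of_mem hz, hz']
      rw [h1.fderiv_eq, fderiv_const_mul
        ((hf.contDiffAt (hU.mem_nhds hy)).differentiableAt one_ne_zero)]
      rfl
    · rw [indicator_of_notMem hy]
      have h1 : U.indicator (fun z ↦ s z * f z) =ᶠ[𝓝 y] fun _ ↦ 0 := by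
        filter_upwards [hK.isClosed.isOpen_compl.mem_nhds fun h ↦ hy (hKU h)] with z hz
        exact indicator_apply_eq_zero.2 fun hzU ↦ hsf0 z hzU hz
      rw [h1.fderiv_eq]
      simp
  constructor
  · rw [← integrable_indicator_iff hU.measurableSet, ← hfd]
    exact ((hc.continuous_fderiv one_ne_zero).clm_apply
      continuous_const).integrable_of_hasCompactSupport (hcs.fderiv_apply ℝ v)
  · rw [← integral_indicator hU.measurableSet, ← hfd]
    exact integral_fderiv_apply_eq_zero_of_hasCompactSupport hc hcs v

end Euclidean

/-! ### Densities and integrals in a chart -/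

section ChartIntegral

open Topology Set MeasureTheory Module

variable {n : ℕ} {M : Type*} [TopologicalSpace M] [ChartedSpace (EuclideanSpace ℝ (Fin n)) M]

/-- The standard basis of Euclidean space, as a basis in the sense of linear algebra. -/
def stdBasis (n : ℕ) : Basis (Fin n) ℝ (EuclideanSpace ℝ (Fin n)) :=
  (EuclideanSpace.basisFun (Fin n) ℝ).toBasis

/-- The frame of coordinate vectors of the chart around `j`. -/
def coordFrame (j : M) (y : EuclideanSpace ℝ (Fin n)) (i : Fin n) :
    TangentSpace (𝓡 n) ((extChartAt (𝓡 n) j).symm y) :=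
  mfderiv 𝓘(ℝ, EuclideanSpace ℝ (Fin n)) (𝓡 n) (extChartAt (𝓡 n) j).symm y (stdBasis n i)

/-- The coefficient of a top-degree form in the chart around `j`. -/
def topCoeff (j : M) (μ : (x : M) → (TangentSpace (𝓡 n) x) [⋀^Fin n]→ₗ[ℝ] ℝ)
    (y : EuclideanSpace ℝ (Fin n)) : ℝ :=
  μ ((extChartAt (𝓡 n) j).symm y) (coordFrame j y)

/-- The integral of a function supported in the chart around `j`, for the density `|μ|`. -/
def chartIntegral (μ : (x : M) → (TangentSpace (𝓡 n) x) [⋀^Fin n]→ₗ[ℝ] ℝ) (j : M) (h : M → ℝ) :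
    ℝ :=
  ∫ y in (extChartAt (𝓡 n) j).target, h ((extChartAt (𝓡 n) j).symm y) * |topCoeff j μ y|

theorem alternating_apply_comp_stdBasis (ν : EuclideanSpace ℝ (Fin n) [⋀^Fin n]→ₗ[ℝ] ℝ)
    (L : EuclideanSpace ℝ (Fin n) →L[ℝ] EuclideanSpace ℝ (Fin n)) :
    ν (fun i ↦ L (stdBasis n i)) = L.det * ν (stdBasis n) := by
  rw [ν.eq_smul_basis_det (stdBasis n)]
  have h := (stdBasis n).det_comp (L : EuclideanSpace ℝ (Fin n) →ₗ[ℝ] _) (stdBasis n)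
  simp only [AlternatingMap.smul_apply, Basis.det_self, smul_eq_mul, mul_one] at h ⊢
  rw [mul_comm]
  congr 1

theorem topForm_apply_congr (μ : (x : M) → (TangentSpace (𝓡 n) x) [⋀^Fin n]→ₗ[ℝ] ℝ) {p q : M}
    (h : p = q) (v : Fin n → EuclideanSpace ℝ (Fin n)) :
    μ p (fun i ↦ (v i : TangentSpace (𝓡 n) p)) = μ q (fun i ↦ (v i : TangentSpace (𝓡 n) q)) := by
  subst h
  rfl

theorem chartIntegral_eq_setIntegral (μ : (x : M) → (TangentSpace (𝓡 n) x) [⋀^Fin n]→ₗ[ℝ] ℝ)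
    (j x : M) {h : M → ℝ} (hx : ∀ p ∉ (extChartAt (𝓡 n) x).source, h p = 0) :
    chartIntegral μ j h =
      ∫ y in (extChartAt (𝓡 n) j).target ∩
        (extChartAt (𝓡 n) j).symm ⁻¹' (extChartAt (𝓡 n) x).source,
        h ((extChartAt (𝓡 n) j).symm y) * |topCoeff j μ y| := by
  refine setIntegral_eq_of_subset_of_forall_sdiff_eq_zero
    (isOpen_extChartAt_target j).measurableSet inter_subset_left fun y hy ↦ ?_
  rw [hx _ fun h' ↦ hy.2 ⟨hy.1, h'⟩, zero_mul]

/-- The ratio of two top-degree forms. -/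
def topRatio (ν μ : (x : M) → (TangentSpace (𝓡 n) x) [⋀^Fin n]→ₗ[ℝ] ℝ) (x : M) : ℝ :=
  ν x (stdBasis n) / μ x (stdBasis n)

/-- The frame `stdBasis` in `topRatio` is unrelated to the chart `j`; frame independence of the
ratio makes this harmless. -/
theorem topRatio_mul_topCoeff (ν μ : (x : M) → (TangentSpace (𝓡 n) x) [⋀^Fin n]→ₗ[ℝ] ℝ)
    (hμ : ∀ x, μ x (stdBasis n) ≠ 0) (j : M) (y : EuclideanSpace ℝ (Fin n)) :
    topRatio ν μ ((extChartAt (𝓡 n) j).symm y) * topCoeff j μ y = topCoeff j ν y := by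
  rw [topRatio, div_mul_eq_mul_div, div_eq_iff (hμ _), topCoeff, topCoeff]
  exact (alternating_mul_comm_of_basis (V := EuclideanSpace ℝ (Fin n)) (stdBasis n) _ _ _).symm

variable [IsManifold (𝓡 n) ∞ M]

theorem topCoeff_transition (μ : (x : M) → (TangentSpace (𝓡 n) x) [⋀^Fin n]→ₗ[ℝ] ℝ) (j x : M)
    {y : EuclideanSpace ℝ (Fin n)} (hy : y ∈ (extChartAt (𝓡 n) j).target)
    (hx : (extChartAt (𝓡 n) j).symm y ∈ (extChartAt (𝓡 n) x).source) :
    topCoeff j μ y = (fderiv ℝ (extChartAt (𝓡 n) x ∘ (extChartAt (𝓡 n) j).symm) y).det *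
      topCoeff x μ ((extChartAt (𝓡 n) x ∘ (extChartAt (𝓡 n) j).symm) y) := by
  set τ := extChartAt (𝓡 n) x ∘ (extChartAt (𝓡 n) j).symm with hτ
  have h := topForm_apply_congr μ ((extChartAt (𝓡 n) x).left_inv hx).symm (coordFrame j y)
  refine h.trans ?_
  simp only [coordFrame, mfderiv_extChartAt_symm_transition j x hy hx]
  exact alternating_apply_comp_stdBasis ((μ ((extChartAt (𝓡 n) x).symm (τ y))).compLinearMap
    (mfderiv 𝓘(ℝ, EuclideanSpace ℝ (Fin n)) (𝓡 n) (extChartAt (𝓡 n) x).symm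
      (τ y)).toLinearMap) (fderiv ℝ τ y)

/-- Change of variables: the integral of a function supported in two chart domains does not depend
on the chart. -/
theorem chartIntegral_eq (μ : (x : M) → (TangentSpace (𝓡 n) x) [⋀^Fin n]→ₗ[ℝ] ℝ) (j x : M)
    {h : M → ℝ} (hj : ∀ p ∉ (extChartAt (𝓡 n) j).source, h p = 0)
    (hx : ∀ p ∉ (extChartAt (𝓡 n) x).source, h p = 0) :
    chartIntegral μ j h = chartIntegral μ x h := by
  rw [chartIntegral_eq_setIntegral μ j x hx, chartIntegral_eq_setIntegral μ x j hj]
  set τ := extChartAt (𝓡 n) x ∘ (extChartAt (𝓡 n) j).symm with hτ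
  set S := (extChartAt (𝓡 n) j).target ∩
    (extChartAt (𝓡 n) j).symm ⁻¹' (extChartAt (𝓡 n) x).source with hS
  have hSo : IsOpen S :=
    (continuousOn_extChartAt_symm j).isOpen_inter_preimage (isOpen_extChartAt_target j)
      (isOpen_extChartAt_source x)
  have himg : τ '' S = (extChartAt (𝓡 n) x).target ∩
      (extChartAt (𝓡 n) x).symm ⁻¹' (extChartAt (𝓡 n) j).source := by
    ext z
    constructor
    · rintro ⟨y, hy, rfl⟩
      refine ⟨(extChartAt (𝓡 n) x).map_source hy.2, ?_⟩
      rw [mem_preimage, hτ, Function.comp_apply, (extChartAt (𝓡 n) x).left_inv hy.2]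
      exact (extChartAt (𝓡 n) j).map_target hy.1
    · rintro ⟨h1, h2⟩
      refine ⟨extChartAt (𝓡 n) j ((extChartAt (𝓡 n) x).symm z),
        ⟨(extChartAt (𝓡 n) j).map_source h2, ?_⟩, ?_⟩
      · rw [mem_preimage, (extChartAt (𝓡 n) j).left_inv h2]
        exact (extChartAt (𝓡 n) x).map_target h1
      · rw [hτ, Function.comp_apply, (extChartAt (𝓡 n) j).left_inv h2,
          (extChartAt (𝓡 n) x).right_inv h1]
  have hinj : InjOn τ S := by
    intro y hy z hz hyz
    have h1 := (extChartAt (𝓡 n) x).injOn hy.2 hz.2 hyz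
    exact (extChartAt (𝓡 n) j).symm.injOn hy.1 hz.1 h1
  -- The Jacobian factor `|det|` is exactly the one by which `|topCoeff|` changes, so no orientation
  -- of the charts is needed.
  rw [← himg, integral_image_eq_integral_abs_det_fderiv_smul volume hSo.measurableSet
    (f' := fderiv ℝ τ) (fun y hy ↦ ((contDiffAt_chart_transition j x hy.1 hy.2).differentiableAt
      (by simp)).hasFDerivAt.hasFDerivWithinAt) hinj]
  refine setIntegral_congr_fun hSo.measurableSet fun y hy ↦ ?_
  simp only [smul_eq_mul]
  rw [topCoeff_transition μ j x hy.1 hy.2, abs_mul, hτ, Function.comp_apply,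
    (extChartAt (𝓡 n) x).left_inv hy.2]
  ring

theorem topCoeff_ne_zero (μ : (x : M) → (TangentSpace (𝓡 n) x) [⋀^Fin n]→ₗ[ℝ] ℝ)
    (hμ : ∀ x, μ x (stdBasis n) ≠ 0) (j : M) {y : EuclideanSpace ℝ (Fin n)}
    (hy : y ∈ (extChartAt (𝓡 n) j).target) : topCoeff j μ y ≠ 0 := by
  have : IsManifold (𝓡 n) 1 M := IsManifold.of_le (n := ∞) (by simp)
  have hinv := isInvertible_mfderivWithin_extChartAt_symm (I := 𝓡 n) hy
  rw [ModelWithCorners.range_eq_univ, mfderivWithin_univ] at hinv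
  obtain ⟨A, hA⟩ := hinv
  have hb : ((stdBasis n).map
      (A.toLinearEquiv : EuclideanSpace ℝ (Fin n) ≃ₗ[ℝ] EuclideanSpace ℝ (Fin n)) :
        Fin n → EuclideanSpace ℝ (Fin n)) = coordFrame j y := by
    ext1 i
    rw [coordFrame, ← hA]
    rfl
  have h := (AlternatingMap.map_basis_ne_zero_iff (M := EuclideanSpace ℝ (Fin n)) (stdBasis n)
    (μ ((extChartAt (𝓡 n) j).symm y))).1 (hμ _)
  have h2 := (AlternatingMap.map_basis_ne_zero_iff (M := EuclideanSpace ℝ (Fin n))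
    ((stdBasis n).map
      (A.toLinearEquiv : EuclideanSpace ℝ (Fin n) ≃ₗ[ℝ] EuclideanSpace ℝ (Fin n)))
    (μ ((extChartAt (𝓡 n) j).symm y))).2 h
  rw [topCoeff, ← hb]
  exact h2

end ChartIntegral

/-! ### Coordinate components of a 1-form and its exterior derivative -/

section Stokes

open Topology Set MeasureTheory Module

variable {n : ℕ} {M : Type*} [TopologicalSpace M] [ChartedSpace (EuclideanSpace ℝ (Fin n)) M]

/-- A 1-form at a point, as a linear functional. -/
def toCovector (b : DiffForm n 1 M) (x : M) : TangentSpace (𝓡 n) x →ₗ[ℝ] ℝ :=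
  (AlternatingMap.ofSubsingleton ℝ (TangentSpace (𝓡 n) x) ℝ (0 : Fin 1)).symm
    (b x).toAlternatingMap

/-- The differential of a function at a point, as a linear functional. -/
def differential (ρ : M → ℝ) (x : M) : TangentSpace (𝓡 n) x →ₗ[ℝ] ℝ :=
  (show TangentSpace (𝓡 n) x →L[ℝ] ℝ from mfderiv (𝓡 n) 𝓘(ℝ, ℝ) ρ x).toLinearMap

/-- The components of a 1-form in the chart around `j`. -/
def comp₁ (j : M) (b : DiffForm n 1 M) (i : Fin n) (y : EuclideanSpace ℝ (Fin n)) : ℝ :=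
  formInChart j b y fun _ ↦ stdBasis n i

/-- The components of a 2-form in the chart around `j`. -/
def comp₂ (j : M) (β : DiffForm n 2 M) (i k : Fin n) (y : EuclideanSpace ℝ (Fin n)) : ℝ :=
  formInChart j β y ![stdBasis n i, stdBasis n k]

theorem comp₂_eq (j : M) (β : DiffForm n 2 M) (i k : Fin n) (y : EuclideanSpace ℝ (Fin n)) :
    comp₂ j β i k y =
      (β ((extChartAt (𝓡 n) j).symm y)).toAlternatingMap ![coordFrame j y i, coordFrame j y k] := by
  rw [comp₂, formInChart_apply]
  refine congrArg (β ((extChartAt (𝓡 n) j).symm y)) ?_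
  ext1 l
  fin_cases l <;> rfl

variable [IsManifold (𝓡 n) ∞ M]

theorem contDiffOn_comp₁ {b : DiffForm n 1 M} (hb : IsSmoothForm b) (j : M) (i : Fin n) :
    ContDiffOn ℝ ∞ (comp₁ j b i) (extChartAt (𝓡 n) j).target :=
  hb.contDiffOn_formInChart_apply j _

theorem comp₂_extDerivForm {b : DiffForm n 1 M} (hb : IsSmoothForm b) (j : M) (i k : Fin n)
    {y : EuclideanSpace ℝ (Fin n)} (hy : y ∈ (extChartAt (𝓡 n) j).target) :
    comp₂ j (extDerivForm b) i k y =
      fderiv ℝ (comp₁ j b k) y (stdBasis n i) - fderiv ℝ (comp₁ j b i) y (stdBasis n k) := by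
  rw [comp₂, extDeriv_formInChart j hb hy, extDeriv_apply (hb.differentiableAt_formInChart j hy),
    Fin.sum_univ_two]
  have h0 : (fun z ↦ formInChart j b z ((0 : Fin 2).removeNth ![stdBasis n i, stdBasis n k])) =
      comp₁ j b k := by
    ext z
    refine congrArg (formInChart j b z) ?_
    ext1 l
    fin_cases l
    rfl
  have h1 : (fun z ↦ formInChart j b z ((1 : Fin 2).removeNth ![stdBasis n i, stdBasis n k])) =
      comp₁ j b i := by
    ext z
    refine congrArg (formInChart j b z) ?_
    ext1 l
    fin_cases l
    rfl
  rw [h0, h1]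
  simp [sub_eq_add_neg]

theorem contDiffOn_fderiv_apply {E : Type*} [NormedAddCommGroup E] [NormedSpace ℝ E] {U : Set E}
    (hU : IsOpen U) {f : E → ℝ} (hf : ContDiffOn ℝ ∞ f U) (v : E) :
    ContDiffOn ℝ ∞ (fun y ↦ fderiv ℝ f y v) U :=
  (hf.fderiv_of_isOpen hU (by simp)).clm_apply contDiffOn_const

theorem contDiffOn_comp₂_extDerivForm {b : DiffForm n 1 M} (hb : IsSmoothForm b) (j : M)
    (i k : Fin n) : ContDiffOn ℝ ∞ (comp₂ j (extDerivForm b) i k) (extChartAt (𝓡 n) j).target :=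
  ((contDiffOn_fderiv_apply (isOpen_extChartAt_target j) (contDiffOn_comp₁ hb j k) _).sub
    (contDiffOn_fderiv_apply (isOpen_extChartAt_target j) (contDiffOn_comp₁ hb j i) _)).congr
    fun _ hy ↦ comp₂_extDerivForm hb j i k hy

theorem fderiv_fderiv_apply_comm {E : Type*} [NormedAddCommGroup E] [NormedSpace ℝ E] {f : E → ℝ}
    {y : E} (hf : ContDiffAt ℝ ∞ f y) (v w : E) :
    fderiv ℝ (fun z ↦ fderiv ℝ f z v) y w = fderiv ℝ (fun z ↦ fderiv ℝ f z w) y v := by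
  have hd : DifferentiableAt ℝ (fderiv ℝ f) y :=
    (hf.fderiv_right (m := ∞) (by simp)).differentiableAt (by simp)
  have hs : IsSymmSndFDerivAt ℝ f y := hf.isSymmSndFDerivAt
    minSmoothness_two_le_infty
  have h : ∀ a c, fderiv ℝ (fun z ↦ fderiv ℝ f z a) y c = fderiv ℝ (fderiv ℝ f) y c a := by
    intro a c
    rw [fderiv_clm_apply hd (differentiableAt_const a)]
    simp
  rw [h, h, hs.eq]

/-- This is `d(db) = 0` in components: the second derivatives of `b` cancel in pairs by symmetry. -/
theorem comp₂_extDerivForm_cyclic {b : DiffForm n 1 M} (hb : IsSmoothForm b) (j : M)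
    (i k l : Fin n) {y : EuclideanSpace ℝ (Fin n)} (hy : y ∈ (extChartAt (𝓡 n) j).target) :
    fderiv ℝ (comp₂ j (extDerivForm b) k l) y (stdBasis n i)
      - fderiv ℝ (comp₂ j (extDerivForm b) i l) y (stdBasis n k)
      + fderiv ℝ (comp₂ j (extDerivForm b) i k) y (stdBasis n l) = 0 := by
  have hat : ∀ m, ContDiffAt ℝ ∞ (comp₁ j b m) y := fun m ↦
    (contDiffOn_comp₁ hb j m).contDiffAt ((isOpen_extChartAt_target j).mem_nhds hy)
  have hd : ∀ m p, DifferentiableAt ℝ (fun z ↦ fderiv ℝ (comp₁ j b m) z (stdBasis n p)) y :=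
    fun m p ↦ ((((hat m).fderiv_right (m := ∞) (by simp)).differentiableAt (by simp)).clm_apply
      (differentiableAt_const _))
  have h : ∀ p q r, fderiv ℝ (comp₂ j (extDerivForm b) p q) y (stdBasis n r) =
      fderiv ℝ (fun z ↦ fderiv ℝ (comp₁ j b q) z (stdBasis n p)) y (stdBasis n r) -
      fderiv ℝ (fun z ↦ fderiv ℝ (comp₁ j b p) z (stdBasis n q)) y (stdBasis n r) := by
    intro p q r
    have hev : comp₂ j (extDerivForm b) p q =ᶠ[𝓝 y] fun z ↦
        fderiv ℝ (comp₁ j b q) z (stdBasis n p) - fderiv ℝ (comp₁ j b p) z (stdBasis n q) := by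
      filter_upwards [(isOpen_extChartAt_target j).mem_nhds hy] with z hz
      exact comp₂_extDerivForm hb j p q hz
    rw [hev.fderiv_eq, fderiv_fun_sub (hd q p) (hd p q)]
    rfl
  rw [h, h, h, fderiv_fderiv_apply_comm (hat l) (stdBasis n k),
    fderiv_fderiv_apply_comm (hat k) (stdBasis n l),
    fderiv_fderiv_apply_comm (hat i) (stdBasis n l)]
  ring

theorem differential_coordFrame {ρ : M → ℝ} (hρ : ContMDiff (𝓡 n) 𝓘(ℝ, ℝ) ∞ ρ) (j : M)
    {y : EuclideanSpace ℝ (Fin n)} (hy : y ∈ (extChartAt (𝓡 n) j).target) (i : Fin n) :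
    differential ρ ((extChartAt (𝓡 n) j).symm y) (coordFrame j y i) =
      fderiv ℝ (ρ ∘ (extChartAt (𝓡 n) j).symm) y (stdBasis n i) := by
  have h := mfderiv_comp (I := 𝓘(ℝ, EuclideanSpace ℝ (Fin n))) (I' := 𝓡 n) (I'' := 𝓘(ℝ, ℝ)) y
    ((hρ ((extChartAt (𝓡 n) j).symm y)).mdifferentiableAt (by simp))
    ((contMDiffAt_extChartAt_symm_of_mem j hy).mdifferentiableAt (by simp))
  rw [← mfderiv_eq_fderiv, h]
  rfl

theorem contDiffOn_comp_extChartAt_symm {ρ : M → ℝ} (hρ : ContMDiff (𝓡 n) 𝓘(ℝ, ℝ) ∞ ρ) (j : M) :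
    ContDiffOn ℝ ∞ (ρ ∘ (extChartAt (𝓡 n) j).symm) (extChartAt (𝓡 n) j).target := by
  rw [← contMDiffOn_iff_contDiffOn]
  exact hρ.comp_contMDiffOn (contMDiffOn_extChartAt_symm j)

end Stokes

/-! ### Stokes' theorem in a single chart -/

section DimensionFour

open Topology Set MeasureTheory Module

variable {M : Type*} [TopologicalSpace M] [ChartedSpace (EuclideanSpace ℝ (Fin 4)) M]

theorem topCoeff_sqForm (j : M) (β : DiffForm 4 2 M) (y : EuclideanSpace ℝ (Fin 4)) :
    topCoeff j (sqForm β) y = 2 * (comp₂ j β 0 1 y * comp₂ j β 2 3 y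
      - comp₂ j β 0 2 y * comp₂ j β 1 3 y + comp₂ j β 0 3 y * comp₂ j β 1 2 y) := by
  simp only [comp₂_eq]
  refine (wedge_apply_two_two _ _ _).trans ?_
  ring

theorem continuousOn_topCoeff_sqForm {j : M} {β : DiffForm 4 2 M} {U : Set _}
    (h : ∀ i k, ContinuousOn (comp₂ j β i k) U) : ContinuousOn (topCoeff j (sqForm β)) U := by
  have heq : topCoeff j (sqForm β) = fun y ↦ 2 * (comp₂ j β 0 1 y * comp₂ j β 2 3 y
      - comp₂ j β 0 2 y * comp₂ j β 1 3 y + comp₂ j β 0 3 y * comp₂ j β 1 2 y) :=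
    funext (topCoeff_sqForm j β)
  rw [heq]
  exact continuousOn_const.mul ((((h 0 1).mul (h 2 3)).sub ((h 0 2).mul (h 1 3))).add
    ((h 0 3).mul (h 1 2)))

/-- The 4-form `dρ ∧ b ∧ db`. -/
def fluxForm (b : DiffForm 4 1 M) (ρ : M → ℝ) (x : M) : (TangentSpace (𝓡 4) x) [⋀^Fin 4]→ₗ[ℝ] ℝ :=
  wedge (wedgeCovectors (differential ρ x) (toCovector b x)) (extDerivForm b x).toAlternatingMap

variable [IsManifold (𝓡 4) ∞ M]

theorem topCoeff_fluxForm (b : DiffForm 4 1 M) {ρ : M → ℝ} (hρ : ContMDiff (𝓡 4) 𝓘(ℝ, ℝ) ∞ ρ)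
    (j : M) {y : EuclideanSpace ℝ (Fin 4)} (hy : y ∈ (extChartAt (𝓡 4) j).target) :
    topCoeff j (fluxForm b ρ) y =
      ∑ k, fderiv ℝ (ρ ∘ (extChartAt (𝓡 4) j).symm) y (stdBasis 4 k) *
        dualField (comp₁ j b) (comp₂ j (extDerivForm b)) k y := by
  have hb : ∀ i, toCovector b ((extChartAt (𝓡 4) j).symm y) (coordFrame j y i) =
      comp₁ j b i y := fun i ↦ rfl
  refine (wedge_apply_two_two _ _ _).trans ?_
  simp only [wedgeCovectors_apply, differential_coordFrame hρ j hy, hb, Fin.sum_univ_four,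
    dualField, Matrix.cons_val, comp₂_eq]
  ring

theorem continuousOn_topCoeff_fluxForm {b : DiffForm 4 1 M} (hb : IsSmoothForm b) {ρ : M → ℝ}
    (hρ : ContMDiff (𝓡 4) 𝓘(ℝ, ℝ) ∞ ρ) (j : M) :
    ContinuousOn (topCoeff j (fluxForm b ρ)) (extChartAt (𝓡 4) j).target := by
  refine ContinuousOn.congr (f := fun y ↦ ∑ k,
    fderiv ℝ (ρ ∘ (extChartAt (𝓡 4) j).symm) y (stdBasis 4 k) *
      dualField (comp₁ j b) (comp₂ j (extDerivForm b)) k y) ?_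
    fun y hy ↦ topCoeff_fluxForm b hρ j hy
  refine continuousOn_finsetSum _ fun k _ ↦ ?_
  exact (contDiffOn_fderiv_apply (isOpen_extChartAt_target j) (contDiffOn_comp_extChartAt_symm hρ j)
    _).continuousOn.mul (contDiffOn_dualField (contDiffOn_comp₁ hb j)
      (contDiffOn_comp₂_extDerivForm hb j) k).continuousOn

/-- The quotient is the sign of `w`. It relates the density `|μ|` to the coefficient of `μ`, and
local constancy lets it be treated as a constant under derivatives. -/
theorem abs_div_self_locallyConstant {X : Type*} [TopologicalSpace X] {w : X → ℝ} {y : X}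
    (hw : ContinuousAt w y) (h0 : w y ≠ 0) : ∀ᶠ z in 𝓝 y, |w z| / w z = |w y| / w y := by
  rcases h0.lt_or_gt with h | h
  · filter_upwards [hw.eventually_lt_const h] with z hz
    rw [abs_of_neg h, abs_of_neg hz, neg_div_self h.ne, neg_div_self hz.ne]
  · filter_upwards [hw.eventually_const_lt h] with z hz
    rw [abs_of_pos h, abs_of_pos hz, div_self h.ne', div_self hz.ne']

variable {b : DiffForm 4 1 M} {Ω : DiffForm 4 2 M}

theorem topRatio_mul_abs_topCoeff (ν μ : (x : M) → (TangentSpace (𝓡 4) x) [⋀^Fin 4]→ₗ[ℝ] ℝ)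
    (hμ : ∀ x, μ x (stdBasis 4) ≠ 0) (j : M) {y : EuclideanSpace ℝ (Fin 4)}
    (hy : y ∈ (extChartAt (𝓡 4) j).target) :
    topRatio ν μ ((extChartAt (𝓡 4) j).symm y) * |topCoeff j μ y| =
      |topCoeff j μ y| / topCoeff j μ y * topCoeff j ν y := by
  rw [← topRatio_mul_topCoeff ν μ hμ]
  field_simp [topCoeff_ne_zero μ hμ j hy]

theorem continuousOn_topRatio_mul_abs_topCoeff
    {ν μ : (x : M) → (TangentSpace (𝓡 4) x) [⋀^Fin 4]→ₗ[ℝ] ℝ}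
    (hμ : ∀ x, μ x (stdBasis 4) ≠ 0) (j : M)
    (hμc : ContinuousOn (topCoeff j μ) (extChartAt (𝓡 4) j).target)
    (hνc : ContinuousOn (topCoeff j ν) (extChartAt (𝓡 4) j).target) :
    ContinuousOn (fun y ↦ topRatio ν μ ((extChartAt (𝓡 4) j).symm y) * |topCoeff j μ y|)
      (extChartAt (𝓡 4) j).target :=
  ((hμc.abs.div hμc fun _ hy ↦ topCoeff_ne_zero μ hμ j hy).mul hνc).congr
    fun _ hy ↦ topRatio_mul_abs_topCoeff ν μ hμ j hy

omit [IsManifold (𝓡 4) ∞ M] in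
theorem isCompact_extChartAt_image [CompactSpace M] {j : M} {K : Set M} (hK : IsClosed K)
    (hKs : K ⊆ (extChartAt (𝓡 4) j).source) : IsCompact (extChartAt (𝓡 4) j '' K) :=
  hK.isCompact.image_of_continuousOn ((continuousOn_extChartAt j).mono hKs)

omit [IsManifold (𝓡 4) ∞ M] in
theorem extChartAt_image_subset_target {j : M} {K : Set M}
    (hKs : K ⊆ (extChartAt (𝓡 4) j).source) :
    extChartAt (𝓡 4) j '' K ⊆ (extChartAt (𝓡 4) j).target := by
  rintro _ ⟨x, hx, rfl⟩
  exact (extChartAt (𝓡 4) j).map_source (hKs hx)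

omit [IsManifold (𝓡 4) ∞ M] in
theorem integrableOn_chart [CompactSpace M] {j : M} {K : Set M} (hK : IsClosed K)
    (hKs : K ⊆ (extChartAt (𝓡 4) j).source) {g : EuclideanSpace ℝ (Fin 4) → ℝ}
    (hg : ContinuousOn g (extChartAt (𝓡 4) j).target)
    (h0 : ∀ y ∈ (extChartAt (𝓡 4) j).target, (extChartAt (𝓡 4) j).symm y ∉ K → g y = 0) :
    IntegrableOn g (extChartAt (𝓡 4) j).target :=
  integrableOn_of_continuousOn_of_eq_zero_off (isOpen_extChartAt_target j)
    (isCompact_extChartAt_image hK hKs) (extChartAt_image_subset_target hKs) hg fun y hy hyK ↦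
      h0 y hy fun hx ↦ hyK ⟨_, hx, (extChartAt (𝓡 4) j).right_inv hy⟩

/-- Stokes' theorem for `ρ b ∧ db`, with `ρ` supported in a chart. -/
theorem setIntegral_flux_add_eq_zero [CompactSpace M] (hb : IsSmoothForm b)
    (hΩ : ∀ x, sqForm Ω x (stdBasis 4) ≠ 0) {j : M}
    (hΩc : ContinuousOn (topCoeff j (sqForm Ω)) (extChartAt (𝓡 4) j).target) {ρ : M → ℝ}
    (hρ : ContMDiff (𝓡 4) 𝓘(ℝ, ℝ) ∞ ρ) (hsupp : tsupport ρ ⊆ (extChartAt (𝓡 4) j).source) :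
    chartIntegral (sqForm Ω) j (fun x ↦ topRatio (fluxForm b ρ) (sqForm Ω) x +
      ρ x * topRatio (sqForm (extDerivForm b)) (sqForm Ω) x) = 0 := by
  have hUo := isOpen_extChartAt_target (I := 𝓡 4) j
  set φ := extChartAt (𝓡 4) j with hφ
  set U := φ.target with hU
  set μ := sqForm Ω with hμ
  have hKc : IsCompact (φ '' tsupport ρ) := isCompact_extChartAt_image (isClosed_tsupport ρ) hsupp
  have hKU : φ '' tsupport ρ ⊆ U := extChartAt_image_subset_target hsupp
  have h0 : ∀ y ∈ U, y ∉ φ '' tsupport ρ → ρ (φ.symm y) = 0 := fun y hy hyK ↦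
    image_eq_zero_of_notMem_tsupport fun hx ↦ hyK ⟨φ.symm y, hx, φ.right_inv hy⟩
  have hu := contDiffOn_comp_extChartAt_symm hρ j
  have hV := contDiffOn_dualField (contDiffOn_comp₁ hb j) (contDiffOn_comp₂_extDerivForm hb j)
  -- The integrand is, up to the local sign of `Ω ∧ Ω`, the divergence of `ρ` times the dual field
  -- of `b ∧ db`; each partial derivative integrates to zero.
  have key := fun k ↦ setIntegral_locallyConstant_mul_fderiv_eq_zero (μ := volume) hUo hKc hKU
    (s := fun y ↦ |topCoeff j μ y| / topCoeff j μ y)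
    (f := fun y ↦ (ρ ∘ φ.symm) y * dualField (comp₁ j b) (comp₂ j (extDerivForm b)) k y)
    (fun y hy ↦ abs_div_self_locallyConstant (hΩc.continuousAt (hUo.mem_nhds hy))
      (topCoeff_ne_zero μ hΩ j hy)) ((hu.mul (hV k)).of_le (by simp))
    (fun y hy hyK ↦ by rw [Function.comp_apply, h0 y hy hyK, zero_mul]) (stdBasis 4 k)
  have hsum : ∑ k, ∫ y in U, |topCoeff j μ y| / topCoeff j μ y * fderiv ℝ (fun y ↦ (ρ ∘ φ.symm) y *
      dualField (comp₁ j b) (comp₂ j (extDerivForm b)) k y) y (stdBasis 4 k) = 0 :=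
    Finset.sum_eq_zero fun k _ ↦ (key k).2
  rw [← integral_finsetSum _ fun k _ ↦ (key k).1] at hsum
  rw [chartIntegral, ← hsum]
  refine setIntegral_congr_fun hUo.measurableSet fun y hy ↦ ?_
  have hat : ∀ {f : EuclideanSpace ℝ (Fin 4) → ℝ}, ContDiffOn ℝ ∞ f U → DifferentiableAt ℝ f y :=
    fun hf ↦ (hf.contDiffAt (hUo.mem_nhds hy)).differentiableAt (by simp)
  have hdiv := sum_fderiv_mul_dualField (stdBasis 4) (hat hu)
    (fun i ↦ hat (contDiffOn_comp₁ hb j i)) (fun i k ↦ hat (contDiffOn_comp₂_extDerivForm hb j i k))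
    (fun i k ↦ comp₂_extDerivForm hb j i k hy) (fun i k l ↦ comp₂_extDerivForm_cyclic hb j i k l hy)
  rw [← Finset.mul_sum, hdiv, add_mul, mul_assoc, topRatio_mul_abs_topCoeff _ _ hΩ j hy,
    topRatio_mul_abs_topCoeff _ _ hΩ j hy, topCoeff_fluxForm b hρ j hy,
    topCoeff_sqForm j (extDerivForm b)]
  simp only [Function.comp_apply]
  ring

end DimensionFour

/-! ### From charts to the closed manifold -/

section Global

open Topology Set MeasureTheory Module

variable {M : Type*} [TopologicalSpace M] [ChartedSpace (EuclideanSpace ℝ (Fin 4)) M]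

theorem differential_const {n : ℕ} {M : Type*} [TopologicalSpace M]
    [ChartedSpace (EuclideanSpace ℝ (Fin n)) M] (c : ℝ) (p : M) (v : TangentSpace (𝓡 n) p) :
    differential (fun _ : M ↦ c) p v = 0 :=
  congrArg (fun L : EuclideanSpace ℝ (Fin n) →L[ℝ] ℝ ↦ L v)
    (mfderiv_const (I := 𝓡 n) (I' := 𝓘(ℝ, ℝ)) (c := c) (x := p))

theorem differential_eq_zero_of_notMem_tsupport {n : ℕ} {M : Type*} [TopologicalSpace M]
    [ChartedSpace (EuclideanSpace ℝ (Fin n)) M] {ρ : M → ℝ} {p : M} (hp : p ∉ tsupport ρ)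
    (v : TangentSpace (𝓡 n) p) : differential ρ p v = 0 := by
  have hev : ρ =ᶠ[𝓝 p] fun _ ↦ (0 : ℝ) := by
    filter_upwards [(isClosed_tsupport ρ).isOpen_compl.mem_nhds hp] with z hz
    exact image_eq_zero_of_notMem_tsupport hz
  have h := hev.mfderiv_eq (I := 𝓡 n) (I' := 𝓘(ℝ, ℝ))
  rw [mfderiv_const] at h
  exact congrArg (fun L : EuclideanSpace ℝ (Fin n) →L[ℝ] ℝ ↦ L v) h

theorem sum_differential_eq_zero {n : ℕ} {M ι : Type*} [TopologicalSpace M]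
    [ChartedSpace (EuclideanSpace ℝ (Fin n)) M] {ρ : ι → M → ℝ} {s : Finset ι} {c : ℝ}
    (hρ : ∀ i, ContMDiff (𝓡 n) 𝓘(ℝ, ℝ) ∞ (ρ i)) (hsum : ∀ x, ∑ i ∈ s, ρ i x = c) (p : M)
    (v : TangentSpace (𝓡 n) p) : ∑ i ∈ s, differential (ρ i) p v = 0 := by
  classical
  have hs : MDifferentiableAt (𝓡 n) 𝓘(ℝ, ℝ) (∑ i ∈ s, ρ i) p ∧
      ∑ i ∈ s, differential (ρ i) p v = differential (∑ i ∈ s, ρ i) p v := by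
    clear hsum
    induction s using Finset.induction_on with
    | empty => exact ⟨mdifferentiableAt_const, (differential_const (0 : ℝ) p v).symm⟩
    | insert i s hi ih =>
      have hi' := (hρ i p).mdifferentiableAt (by simp)
      rw [Finset.sum_insert hi, Finset.sum_insert hi, ih.2]
      refine ⟨hi'.add ih.1, ?_⟩
      exact congrArg (fun L : EuclideanSpace ℝ (Fin n) →L[ℝ] ℝ ↦ L v) (mfderiv_add hi' ih.1).symm
  have hc : (∑ i ∈ s, ρ i) = fun _ ↦ c := by
    ext x
    rw [Finset.sum_apply, hsum]
  rw [hs.2, hc, differential_const]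

/-- `dρ ∧ b ∧ db` depends linearly on `dρ`. -/
theorem exists_topRatio_fluxForm_eq (b : DiffForm 4 1 M)
    (μ : (x : M) → (TangentSpace (𝓡 4) x) [⋀^Fin 4]→ₗ[ℝ] ℝ) (x : M) :
    ∃ c : Fin 4 → ℝ, ∀ ρ : M → ℝ, topRatio (fluxForm b ρ) μ x =
      ∑ k, c k * differential ρ x (stdBasis 4 k) := by
  let e : Fin 4 → TangentSpace (𝓡 4) x := stdBasis 4
  let a : Fin 4 → ℝ := fun i ↦ toCovector b x (e i)
  let β : Fin 4 → Fin 4 → ℝ := fun i k ↦ (extDerivForm b x).toAlternatingMap ![e i, e k]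
  -- The pattern of `dualField`, in the frame `stdBasis` at `x`, divided by `μ`. Independence of `ρ`
  -- is what allows summing over a partition of unity.
  refine ⟨![(a 1 * β 2 3 - a 2 * β 1 3 + a 3 * β 1 2) / μ x (stdBasis 4),
    -(a 0 * β 2 3 - a 2 * β 0 3 + a 3 * β 0 2) / μ x (stdBasis 4),
    (a 0 * β 1 3 - a 1 * β 0 3 + a 3 * β 0 1) / μ x (stdBasis 4),
    -(a 0 * β 1 2 - a 1 * β 0 2 + a 2 * β 0 1) / μ x (stdBasis 4)], fun ρ ↦ ?_⟩
  have h : fluxForm b ρ x (stdBasis 4) = _ := wedge_apply_two_two _ _ e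
  rw [topRatio, h]
  simp only [wedgeCovectors_apply, Fin.sum_univ_four, Matrix.cons_val]
  change _ = (a 1 * β 2 3 - a 2 * β 1 3 + a 3 * β 1 2) / μ x (stdBasis 4) * differential ρ x (e 0)
    + -(a 0 * β 2 3 - a 2 * β 0 3 + a 3 * β 0 2) / μ x (stdBasis 4) * differential ρ x (e 1)
    + (a 0 * β 1 3 - a 1 * β 0 3 + a 3 * β 0 1) / μ x (stdBasis 4) * differential ρ x (e 2)
    + -(a 0 * β 1 2 - a 1 * β 0 2 + a 2 * β 0 1) / μ x (stdBasis 4) * differential ρ x (e 3)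
  simp only [a, β]
  ring

variable [IsManifold (𝓡 4) ∞ M] [T2Space M] [CompactSpace M]

/-- If `db ∧ db` is nonpositive relative to a nowhere vanishing 4-form on a closed manifold, then
it vanishes. -/
theorem topRatio_sqForm_extDerivForm_eq_zero {b : DiffForm 4 1 M} {Ω : DiffForm 4 2 M}
    (hb : IsSmoothForm b) (hΩ : ∀ x, sqForm Ω x (stdBasis 4) ≠ 0)
    (hΩc : ∀ j, ContinuousOn (topCoeff j (sqForm Ω)) (extChartAt (𝓡 4) j).target)
    (hf : ∀ x, topRatio (sqForm (extDerivForm b)) (sqForm Ω) x ≤ 0) (x : M) :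
    topRatio (sqForm (extDerivForm b)) (sqForm Ω) x = 0 := by
  obtain ⟨ρ, hρs⟩ := SmoothPartitionOfUnity.exists_isSubordinate_chartAt_source (𝓡 4) M
  have hsupp : ∀ i, tsupport (ρ i) ⊆ (extChartAt (𝓡 4) i).source := fun i ↦ by
    rw [extChartAt_source]
    exact hρs i
  have hρ : ∀ i, ContMDiff (𝓡 4) 𝓘(ℝ, ℝ) ∞ (ρ i) := fun i ↦ (ρ i).contMDiff
  have hfin := ρ.locallyFinite.finite_nonempty_of_compact
  let s : Finset M := hfin.toFinset
  have hsum : ∀ p, ∑ i ∈ s, ρ i p = 1 := fun p ↦ by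
    rw [← ρ.sum_eq_one (mem_univ p)]
    refine (finsum_eq_sum_of_support_subset _ fun i hi ↦ ?_).symm
    exact Finset.mem_coe.2 (hfin.mem_toFinset.2 ⟨p, hi⟩)
  set μ := sqForm Ω with hμ
  set f := topRatio (sqForm (extDerivForm b)) μ with hfdef
  let T : M → M → ℝ := fun i ↦ topRatio (fluxForm b (ρ i)) μ
  have hTc : ∀ i j, ContinuousOn (fun y ↦ T i ((extChartAt (𝓡 4) j).symm y) * |topCoeff j μ y|)
      (extChartAt (𝓡 4) j).target := fun i j ↦
    continuousOn_topRatio_mul_abs_topCoeff hΩ j (hΩc j) (continuousOn_topCoeff_fluxForm hb (hρ i) j)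
  have hfc : ∀ j, ContinuousOn (fun y ↦ f ((extChartAt (𝓡 4) j).symm y) * |topCoeff j μ y|)
      (extChartAt (𝓡 4) j).target := fun j ↦
    continuousOn_topRatio_mul_abs_topCoeff hΩ j (hΩc j) (continuousOn_topCoeff_sqForm fun i k ↦
      (contDiffOn_comp₂_extDerivForm hb j i k).continuousOn)
  have hρc : ∀ i j, ContinuousOn (fun y ↦ ρ i ((extChartAt (𝓡 4) j).symm y))
      (extChartAt (𝓡 4) j).target := fun i j ↦
    (contDiffOn_comp_extChartAt_symm (hρ i) j).continuousOn
  have hρ0 : ∀ i p, p ∉ tsupport (ρ i) → ρ i p = 0 := fun i p ↦ image_eq_zero_of_notMem_tsupport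
  have hT0 : ∀ i p, p ∉ tsupport (ρ i) → T i p = 0 := fun i p hp ↦ by
    obtain ⟨c, hc⟩ := exists_topRatio_fluxForm_eq b μ p
    simp only [T, hc]
    exact Finset.sum_eq_zero fun k _ ↦
      mul_eq_zero_of_right _ (differential_eq_zero_of_notMem_tsupport hp _)
  have hTsum : ∀ p, ∑ i ∈ s, T i p = 0 := fun p ↦ by
    obtain ⟨c, hc⟩ := exists_topRatio_fluxForm_eq b μ p
    simp only [T, hc]
    rw [Finset.sum_comm]
    refine Finset.sum_eq_zero fun k _ ↦ ?_
    rw [← Finset.mul_sum]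
    exact mul_eq_zero_of_right _ (sum_differential_eq_zero (ρ := fun i ↦ ρ i) hρ hsum p _)
  -- Integrability in the chart `k` needs one factor to be supported there, which holds if `k` is
  -- `i` or `j`; the second alternative sets the other charts aside.
  have hint : ∀ i j k, IntegrableOn (fun y ↦ ρ i ((extChartAt (𝓡 4) k).symm y) *
      T j ((extChartAt (𝓡 4) k).symm y) * |topCoeff k μ y|) (extChartAt (𝓡 4) k).target ∨
      (k ≠ i ∧ k ≠ j) := by
    intro i j k
    by_cases h : k = i ∨ k = j
    · left
      have hcont : ContinuousOn (fun y ↦ ρ i ((extChartAt (𝓡 4) k).symm y) *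
          T j ((extChartAt (𝓡 4) k).symm y) * |topCoeff k μ y|) (extChartAt (𝓡 4) k).target := by
        simp only [mul_assoc]
        exact (hρc i k).mul (hTc j k)
      rcases h with rfl | rfl
      · exact integrableOn_chart (isClosed_tsupport _) (hsupp k) hcont fun y _ hy ↦ by
          rw [hρ0 k _ hy, zero_mul, zero_mul]
      · exact integrableOn_chart (isClosed_tsupport _) (hsupp k) hcont fun y _ hy ↦ by
          rw [hT0 k _ hy, mul_zero, zero_mul]
    · exact Or.inr (not_or.1 h)
  have h1 : ∀ i, chartIntegral μ i (T i) + chartIntegral μ i (fun p ↦ ρ i p * f p) = 0 := by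
    intro i
    rw [← setIntegral_flux_add_eq_zero hb hΩ (hΩc i) (hρ i) (hsupp i)]
    simp only [chartIntegral, add_mul]
    refine (integral_add ?_ ?_).symm
    · exact integrableOn_chart (isClosed_tsupport _) (hsupp i) (hTc i i) fun y _ hy ↦ by
        rw [hT0 i _ hy, zero_mul]
    · refine integrableOn_chart (isClosed_tsupport _) (hsupp i) ?_ fun y _ hy ↦ by
        rw [hρ0 i _ hy, zero_mul, zero_mul]
      simp only [mul_assoc]
      exact (hρc i i).mul (hfc i)
  -- The `T i` live in different charts, so `∑ T i = 0` cannot be used directly. Inserting `1 = ∑ ρ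
  -- j` and moving each piece from chart `i` to chart `j` puts, for fixed `j`, all of them under one
  -- integral.
  have h2 : ∀ i, chartIntegral μ i (T i) = ∑ j ∈ s, chartIntegral μ j fun p ↦ ρ j p * T i p := by
    intro i
    have h : ∀ j ∈ s, chartIntegral μ j (fun p ↦ ρ j p * T i p) =
        chartIntegral μ i fun p ↦ ρ j p * T i p := fun j _ ↦
      chartIntegral_eq μ j i (fun p hp ↦ by rw [hρ0 j p fun h ↦ hp (hsupp j h), zero_mul])
        fun p hp ↦ by rw [hT0 i p fun h ↦ hp (hsupp i h), mul_zero]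
    rw [Finset.sum_congr rfl h]
    simp only [chartIntegral]
    rw [← integral_finsetSum _ fun j _ ↦ (hint j i i).resolve_right fun h ↦ h.2 rfl]
    simp only [← Finset.sum_mul, hsum, one_mul]
  have h3 : ∀ j, ∑ i ∈ s, chartIntegral μ j (fun p ↦ ρ j p * T i p) = 0 := by
    intro j
    simp only [chartIntegral]
    rw [← integral_finsetSum _ fun i _ ↦ (hint j i j).resolve_right fun h ↦ h.1 rfl]
    simp only [← Finset.sum_mul, ← Finset.mul_sum, hTsum, mul_zero, zero_mul, integral_zero]
  have h4 : ∑ i ∈ s, chartIntegral μ i (fun p ↦ ρ i p * f p) = 0 := by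
    have h5 : ∑ i ∈ s, chartIntegral μ i (T i) = 0 := by
      rw [Finset.sum_congr rfl fun i _ ↦ h2 i, Finset.sum_comm]
      exact Finset.sum_eq_zero fun j _ ↦ h3 j
    have h6 := Finset.sum_eq_zero fun i (_ : i ∈ s) ↦ h1 i
    rw [Finset.sum_add_distrib, h5, zero_add] at h6
    exact h6
  have hle : ∀ i p, ρ i p * f p ≤ 0 := fun i p ↦ mul_nonpos_of_nonneg_of_nonpos (ρ.nonneg i p) (hf p)
  -- All summands are nonpositive and their sum is zero, so each one vanishes.
  have h7 : ∀ i ∈ s, chartIntegral μ i (fun p ↦ ρ i p * f p) = 0 := by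
    refine (Finset.sum_eq_zero_iff_of_nonpos fun i _ ↦ ?_).1 h4
    exact integral_nonpos fun y ↦ mul_nonpos_of_nonpos_of_nonneg (hle i _) (abs_nonneg _)
  obtain ⟨i, his, hix⟩ : ∃ i ∈ s, ρ i x ≠ 0 :=
    Finset.exists_ne_zero_of_sum_ne_zero (by rw [hsum]; exact one_ne_zero)
  have hxs : x ∈ (extChartAt (𝓡 4) i).source := hsupp i (subset_tsupport _ hix)
  have hgc : ContinuousOn (fun y ↦ ρ i ((extChartAt (𝓡 4) i).symm y) *
      f ((extChartAt (𝓡 4) i).symm y) * |topCoeff i μ y|) (extChartAt (𝓡 4) i).target := by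
    simp only [mul_assoc]
    exact (hρc i i).mul (hfc i)
  have hgi := integrableOn_chart (isClosed_tsupport _) (hsupp i) hgc fun y _ hy ↦ by
    rw [hρ0 i _ hy, zero_mul, zero_mul]
  have h8 := h7 i his
  rw [chartIntegral, ← neg_eq_zero, ← integral_neg, integral_eq_zero_iff_of_nonneg
    (fun y ↦ neg_nonneg.2 (mul_nonpos_of_nonpos_of_nonneg (hle i _) (abs_nonneg _)))
    hgi.neg] at h8
  -- A continuous function that vanishes almost everywhere on an open set vanishes there; evaluating
  -- at the image of `x`, where `ρ i` and the density are nonzero, isolates `f x`.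
  have h9 := Measure.eqOn_open_of_ae_eq h8 (isOpen_extChartAt_target i) hgc.neg continuousOn_const
    ((extChartAt (𝓡 4) i).map_source hxs)
  have hw := topCoeff_ne_zero μ hΩ i ((extChartAt (𝓡 4) i).map_source hxs)
  simp only [(extChartAt (𝓡 4) i).left_inv hxs, Pi.zero_apply, neg_eq_zero, mul_eq_zero,
    abs_eq_zero, hix, hw, or_false, false_or] at h9
  exact h9

end Global

/-! ### Primitivity of the difference, and the conclusion -/

section Uniqueness

open Module

variable {V : Type*} [AddCommGroup V] [Module ℝ V]

theorem wedge_sub_add_eq_zero {α β : V [⋀^Fin 2]→ₗ[ℝ] ℝ} (h : wedge α α = wedge β β) :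
    wedge (β - α) (α + β) = 0 := by
  ext v
  have hv := congrArg (fun μ ↦ μ v) h
  simp only [wedge_apply_two_two] at hv
  simp only [wedge_apply_two_two, AlternatingMap.sub_apply, AlternatingMap.add_apply,
    AlternatingMap.zero_apply]
  linear_combination -hv

end Uniqueness

end AlmostKahler

end

theorem mainTheorem3 {M : Type*} [TopologicalSpace M] [T2Space M] [CompactSpace M]
    [ChartedSpace (EuclideanSpace ℝ (Fin 4)) M] [IsManifold (𝓡 4) ∞ M]
    (J : (x : M) → TangentSpace (𝓡 4) x →L[ℝ] TangentSpace (𝓡 4) x)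
    (hJ : AlmostKahler.IsAlmostComplexStructure J)
    (ω₁ ω₂ : AlmostKahler.DiffForm 4 2 M)
    (hω₁ : AlmostKahler.IsSymplecticForm ω₁) (hJω₁ : AlmostKahler.IsCompatible J ω₁)
    (hω₂ : AlmostKahler.IsSymplecticForm ω₂) (hJω₂ : AlmostKahler.IsCompatible J ω₂)
    (hcoh : AlmostKahler.Cohomologous ω₁ ω₂)
    (hsq : ∀ x, AlmostKahler.sqForm ω₁ x = AlmostKahler.sqForm ω₂ x) :
    ω₁ = ω₂ := by
  open AlmostKahler in
  obtain ⟨b, hb, hdb⟩ := hcoh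
  have hβ : ∀ x, extDerivForm b x = ω₂ x - ω₁ x := fun x ↦ by rw [hdb x, add_sub_cancel_left]
  -- The sum inherits invariance and positivity, and equality of the squares makes the difference
  -- primitive for it, though not necessarily for `ω₁` or `ω₂` alone.
  let Ω : DiffForm 4 2 M := fun x ↦ ω₁ x + ω₂ x
  have hprim : ∀ x, wedge (extDerivForm b x).toAlternatingMap (Ω x).toAlternatingMap = 0 := by
    intro x
    have h1 : (extDerivForm b x).toAlternatingMap =
        (ω₂ x).toAlternatingMap - (ω₁ x).toAlternatingMap := by
      rw [hβ]
      rfl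
    rw [h1]
    exact wedge_sub_add_eq_zero (hsq x)
  have key := fun x ↦ wedge_self_of_primitive (V := TangentSpace (𝓡 4) x)
    (finrank_euclideanSpace_fin (𝕜 := ℝ) (n := 4)) (J x).toLinearMap (hJ.sq_eq x)
    (Ω x).toAlternatingMap (extDerivForm b x).toAlternatingMap
    (fun v w ↦ congrArg₂ (· + ·) (hJω₁.invariant x v w) (hJω₂.invariant x v w))
    (fun v hv ↦ add_pos (hJω₁.pos x v hv) (hJω₂.pos x v hv))
    (fun v w ↦ by
      rw [hβ]
      exact congrArg₂ (· - ·) (hJω₂.invariant x v w) (hJω₁.invariant x v w))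
    (hprim x) (stdBasis 4)
  have hΩc : ∀ j, ContinuousOn (topCoeff j (sqForm Ω)) (extChartAt (𝓡 4) j).target := fun j ↦
    continuousOn_topCoeff_sqForm fun i k ↦
      ((hω₁.smooth.contDiffOn_formInChart_apply j _).add
        (hω₂.smooth.contDiffOn_formInChart_apply j _)).continuousOn
  have hzero := topRatio_sqForm_extDerivForm_eq_zero hb (fun x ↦ (key x).1) hΩc
    fun x ↦ (key x).2.1
  funext x
  have hx := (key x).2.2 (hzero x)
  have hx' : extDerivForm b x = 0 := ContinuousAlternatingMap.toAlternatingMap_injective hx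
  rw [hdb x, hx', add_zero]
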